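/- Let $N\ge 2$ be an integer, let $\rho,\theta,m,q\in\mathbb R$ satisfy $m>0$, $q\ge 0$ and $\kappa:=m+q-1>0$, and put $$\Theta:=\frac{\theta+2-m}{\kappa},\qquad \beta:=\kappa\Theta+2\rho(m-1).$$ Assume $\beta\neq 0$ and let $\gamma\in(0,\infty)$. For $R>0$ let $\mathcal S_{\gamma,R}$ be the set of positive radial classical ($C^2$) solutions $u=u(r)$, $r=|x|$, of $$\Delta u+(2-N-2\rho)\,\frac{x\cdot\nabla u}{|x|^2}=|x|^\theta u^q|\nabla u|^m\quad\text{in } B_R(0)\setminus\{0\}\subset\mathbb R^N$$ such that $\lim_{r\to0^+}u(r)=\gamma$ and $u$ is not identically equal to $\gamma$ on any interval $(0,r)$ with $0<r<R$. Consider the cases: - (I) $\beta<0$ and $m=1$; - (II) $m\ne1$, $\Theta\neq0$ and $\operatorname{sgn}(\Theta)=\operatorname{sgn}(1-m)$; in this case put $\zeta:=\frac{\kappa\Theta}{1-m}>0$ (note that $\beta\ne0$ gives $\zeta\neq 2\rho$); - (III) $\beta>0$ and $\rho>0$. Consider the following expansions as $r\to0^+$: $$u(r)=\gamma+C\,r^{2\rho-1-\theta}\exp\Big(\frac{\gamma^q}{\theta+1}\,r^{\theta+1}\Big)(1+o(1)),\tag{1}$$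 $$u(r)=\gamma+\frac{\operatorname{sgn}(\zeta-2\rho)}{\zeta}\Big(\frac{\gamma^q}{|\zeta-2\rho|}\Big)^{\frac1{1-m}}r^{\zeta}(1+o(1)),\tag{2}$$ $$u(r)=\gamma+C_1r^{2\rho}+\frac{\gamma^q(2\rho|C_1|)^m}{\beta(2\rho+\beta)}\,r^{2\rho+\beta}(1+o(1)).\tag{3}$$ (A) Let Case (I) hold. Then, for every $R>0$, any $u\in\mathcal S_{\gamma,R}$ satisfies $u'>0$ on $(0,R)$, and there exists a constant $C>0$ such that (1) holds. Moreover, there exists $R>0$ such that $\mathcal S_{\gamma,R}$ is infinite. (B) Let Cases (II) and (III) both hold. Then, for every $R>0$, any $u\in\mathcal S_{\gamma,R}$ satisfies either (2), or (3) for some constant $C_1\in\mathbb R\setminus\{0\}$. (C) Let Case (II) hold. If $\beta>0$, then there exist $R>0$ and $u\in\mathcal S_{\gamma,R}$ satisfying (2). If $\beta<0$, then there exists $R>0$ such that infinitely many $u\in\mathcal S_{\gamma,R}$ satisfy (2). If, in addition, Case (III) fails, then for every $R>0$ any $u\in\mathcal S_{\gamma,R}$ satisfies (2). (D) Let Case (III)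 hold. Then for every $C_1\in\mathbb R\setminus\{0\}$ there exist $R>0$ and $u\in\mathcal S_{\gamma,R}$ such that (3) holds. If, in addition, Case (II) fails, then for every $R>0$ and every $u\in\mathcal S_{\gamma,R}$ there exists $C_1\in\mathbb R\setminus\{0\}$ such that (3) holds. -/

import Mathlib

open Set Filter Topology Asymptotics

noncomputable section

namespace HardyGradient

/-- `κ = m + q - 1`. -/
def kappa (m q : ℝ) : ℝ := m + q - 1

/-- `Θ = (θ + 2 - m) / κ`. -/
def bigTheta (m q theta : ℝ) : ℝ := (theta + 2 - m) / kappa m q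

/-- `β = κ Θ + 2 ρ (m - 1)`. -/
def beta (rho m q theta : ℝ) : ℝ :=
  kappa m q * bigTheta m q theta + 2 * rho * (m - 1)

/-- `ζ = κ Θ / (1 - m)` (used only when `m ≠ 1`). -/
def zeta (m q theta : ℝ) : ℝ := kappa m q * bigTheta m q theta / (1 - m)

/-- The punctured open ball `B_R(0) \ {0}` in `ℝ^N`. -/
def puncturedBall (N : ℕ) (R : ℝ) : Set (EuclideanSpace ℝ (Fin N)) :=
  Metric.ball 0 R \ {0}

/-- `v` is a classical (`C²`) solution in `B_R(0) \ {0} ⊆ ℝ^N` of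
`Δv + (2 - N - 2ρ) (x · ∇v) / |x|² + λ v / |x|² = |x|^θ v^q |∇v|^m`. -/
def IsClassicalSolution (N : ℕ) (rho lam theta m q R : ℝ)
    (v : EuclideanSpace ℝ (Fin N) → ℝ) : Prop :=
  ContDiffOn ℝ 2 v (puncturedBall N R) ∧
  ∀ x ∈ puncturedBall N R,
    Laplacian.laplacian v x
        + (2 - (N : ℝ) - 2 * rho) * (inner ℝ x (gradient v x) / ‖x‖ ^ 2)
        + lam / ‖x‖ ^ 2 * v x
      = ‖x‖ ^ theta * v x ^ q * ‖gradient v x‖ ^ m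

/-- `u`, of which only the values on `(0, R)` matter, is the radial profile of a positive radial
solution `x ↦ u(|x|)` of the equation in `B_R(0) \ {0} ⊆ ℝ^N`. -/
def IsPositiveRadialSolution (N : ℕ) (rho lam theta m q R : ℝ) (u : ℝ → ℝ) : Prop :=
  (∀ r ∈ Ioo 0 R, 0 < u r) ∧
  IsClassicalSolution N rho lam theta m q R (fun x => u ‖x‖)

/-- `r^*(u) = sup {r ∈ (0, R) : u ≡ γ on (0, r)}`, with value `0` when there is no such `r`
(the set is bounded by `R`, and the supremum of the empty set of reals is `0`). -/
def rStar (gam R : ℝ) (u : ℝ → ℝ) : ℝ :=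
  sSup {r : ℝ | r ∈ Ioo 0 R ∧ ∀ s ∈ Ioo 0 r, u s = gam}

/-- The set `𝒮_{γ,R}` of (profiles of) positive radial solutions in `B_R(0) \ {0}` with
`u(r) → γ` as `r → 0⁺` and `r^*(u) = 0`. -/
def solutionSet (N : ℕ) (rho lam theta m q gam R : ℝ) : Set (ℝ → ℝ) :=
  {u | IsPositiveRadialSolution N rho lam theta m q R u ∧
    Tendsto u (𝓝[>] 0) (𝓝 gam) ∧ rStar gam R u = 0}

/-- The functions in `A` have infinitely many distinct restrictions to `(0, R)`, that is, `A`
contains infinitely many functions when functions that agree on `(0, R)` are identified. -/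
def InfiniteOn (R : ℝ) (A : Set (ℝ → ℝ)) : Prop :=
  ((fun u : ℝ → ℝ => (Ioo 0 R).domRestrict u) '' A).Infinite

/-- Case (I): `β < 0` and `m = 1`. -/
def CaseI (rho m q theta : ℝ) : Prop := beta rho m q theta < 0 ∧ m = 1

/-- Case (II): `β ≠ 0`, `m ≠ 1`, `Θ ≠ 0` and `sgn Θ = sgn (1 - m)`. -/
def CaseII (rho m q theta : ℝ) : Prop :=
  beta rho m q theta ≠ 0 ∧ m ≠ 1 ∧ bigTheta m q theta ≠ 0 ∧
    Real.sign (bigTheta m q theta) = Real.sign (1 - m)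

/-- Case (III): `β > 0` and `ρ > 0`. -/
def CaseIII (rho m q theta : ℝ) : Prop := 0 < beta rho m q theta ∧ 0 < rho

/-- `u(r) = γ + C r^(2ρ-1-θ) exp(γ^q r^(θ+1) / (θ+1)) (1 + o(1))` as `r → 0⁺`. -/
def ExpExpansion (rho q theta gam C : ℝ) (u : ℝ → ℝ) : Prop :=
  (fun r => u r - gam) ~[𝓝[>] 0]
    (fun r => C * r ^ (2 * rho - 1 - theta) *
      Real.exp (gam ^ q / (theta + 1) * r ^ (theta + 1)))

/-- `u(r) = γ + (sgn(ζ-2ρ) / ζ) (γ^q / |ζ-2ρ|)^(1/(1-m)) r^ζ (1 + o(1))` as `r → 0⁺`. -/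
def PowerExpansion (rho m q theta gam : ℝ) (u : ℝ → ℝ) : Prop :=
  (fun r => u r - gam) ~[𝓝[>] 0]
    (fun r => Real.sign (zeta m q theta - 2 * rho) / zeta m q theta *
      (gam ^ q / |zeta m q theta - 2 * rho|) ^ (1 / (1 - m)) * r ^ zeta m q theta)

/-- `u(r) = γ + C₁ r^(2ρ) + (γ^q (2ρ|C₁|)^m / (β (2ρ+β))) r^(2ρ+β) (1 + o(1))` as `r → 0⁺`. -/
def RefinedExpansion (rho m q theta gam C₁ : ℝ) (u : ℝ → ℝ) : Prop :=
  (fun r => u r - gam - C₁ * r ^ (2 * rho)) ~[𝓝[>] 0]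
    (fun r => gam ^ q * (2 * rho * |C₁|) ^ m /
        (beta rho m q theta * (2 * rho + beta rho m q theta)) *
      r ^ (2 * rho + beta rho m q theta))

end HardyGradient

end

/-!
For a radial profile `u` put `w = r^(1-2ρ) u'`. The equation becomes the first order system
`u' = r^(2ρ-1) w`, `w' = r^(β-1) u^q |w|^m` (`RadialSystem`), whose second equation is separable: if
`φ` is a primitive of `r^(β-1) u^q`, then `φ = |w|^(1-m) sgn w / (1-m)` (`φ = sgn w log |w|` when
`m = 1`), equivalently `w = Φ(φ)` with `Φ' = |Φ|^m`. Since `u → γ`, `φ' ~ γ^q r^(β-1)`.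

*Asymptotics.* `w` is monotone, and as `u` is not constant near `0`, `w` has a constant sign near
`0` (`RadialSystem.pos_or_neg`). If `β < 0`, then `φ ~ γ^q r^β / β`; if `β > 0`, then `φ` has a limit
`c` at `0`, and either `c = 0` and again `φ ~ γ^q r^β / β`, or `c ≠ 0` and `w` has a nonzero limit.
The first behaviour gives `u' ~ K r^(ζ-1)` for `m ≠ 1`, and the second `u' ~ w₀ r^(2ρ-1)`. The
convergence of `u` forces `ζ > 0`, respectively `ρ > 0`, and integration gives the power expansion
(`RadialSystem.powerExpansion`), respectively the refined one (`RadialSystem.refinedExpansion`). For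
`m = 1` and `β < 0`, `|w|` is exponentially large (`w < 0`, excluded) or exponentially small
(`w > 0`). In the latter case `u - γ` is so small that `log w - γ^q r^β / β` converges
(`RadialSystem.expExpansion`).

*Existence.* All solutions come from one contraction argument for
`u(r) = γ + ∫₀^r s^(2ρ-1) Φ(φ(s)) ds` (`exists_radialSystem_of_flow`), where `φ = potential` is
written in the variable `τ = r^β`, so that `β φ(s)` lies between multiples of `s^β` for both signs of
`β`. The flow `Φ` is the exponential, the explicit power solution of `Φ' = |Φ|^m`, or a local
solution through `w₀ = 2 ρ C₁`. For `β < 0` the potential contains a free constant `a`, which the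
restriction of the solution to `(0, R)` determines; this yields infinitely many solutions.
-/

noncomputable section

namespace HardyGradient

/-! ### Radial solutions and the first order system -/

section Radial

variable {E : Type*} [NormedAddCommGroup E] [InnerProductSpace ℝ E]

theorem hasFDerivAt_norm_of_ne_zero {x : E} (hx : x ≠ 0) :
    HasFDerivAt (fun y : E => ‖y‖) (‖x‖⁻¹ • innerSL ℝ x) x := by
  have h := (Real.hasDerivAt_sqrt (x := ‖x‖ ^ 2) (by positivity)).comp_hasFDerivAt x
    (hasStrictFDerivAt_norm_sq x).hasFDerivAt
  have hx' : ‖x‖ ≠ 0 := norm_ne_zero_iff.2 hx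
  refine (h.congr_fderiv ?_).congr_of_eventuallyEq (.of_forall fun y => ?_)
  · ext z
    simp [Real.sqrt_sq]
    field_simp
  · simp [Real.sqrt_sq]

theorem hasFDerivAt_radial {u : ℝ → ℝ} {u' : ℝ} {x : E} (hx : x ≠ 0)
    (hu : HasDerivAt u u' ‖x‖) :
    HasFDerivAt (fun y : E => u ‖y‖) ((u' / ‖x‖) • innerSL ℝ x) x := by
  refine (hu.comp_hasFDerivAt x (hasFDerivAt_norm_of_ne_zero hx)).congr_fderiv ?_
  rw [smul_smul, div_eq_mul_inv]

theorem gradient_radial [CompleteSpace E] {u : ℝ → ℝ} {u' : ℝ} {x : E} (hx : x ≠ 0)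
    (hu : HasDerivAt u u' ‖x‖) :
    gradient (fun y : E => u ‖y‖) x = (u' / ‖x‖) • x := by
  refine HasGradientAt.gradient ?_
  rw [hasGradientAt_iff_hasFDerivAt]
  refine (hasFDerivAt_radial hx hu).congr_fderiv ?_
  ext z
  simp

/-- The Laplacian of a radial function: `Δ (u ∘ ‖·‖) = u'' + (N - 1) u' / r`. -/
theorem laplacian_radial [FiniteDimensional ℝ E] {u u' : ℝ → ℝ} {u'' : ℝ} {x : E} (hx : x ≠ 0)
    (hu : ∀ᶠ r in 𝓝 ‖x‖, HasDerivAt u (u' r) r) (hu' : HasDerivAt u' u'' ‖x‖) :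
    Laplacian.laplacian (fun y : E => u ‖y‖) x =
      u'' + (Module.finrank ℝ E - 1) * (u' ‖x‖ / ‖x‖) := by
  have hx' : ‖x‖ ≠ 0 := norm_ne_zero_iff.2 hx
  have h1 : fderiv ℝ (fun y : E => u ‖y‖) =ᶠ[𝓝 x] fun y => (u' ‖y‖ / ‖y‖) • innerSL ℝ y := by
    filter_upwards [(continuous_norm.tendsto x).eventually hu, isOpen_ne.mem_nhds hx] with y hy hy0
    exact (hasFDerivAt_radial hy0 hy).fderiv
  have h2 : HasDerivAt (fun r => u' r / r) ((u'' * ‖x‖ - u' ‖x‖ * 1) / ‖x‖ ^ 2) ‖x‖ :=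
    hu'.div (hasDerivAt_id _) hx'
  have h3 := (hasFDerivAt_radial hx h2).smul (innerSL ℝ (E := E)).hasFDerivAt
  have h4 : fderiv ℝ (fderiv ℝ (fun y : E => u ‖y‖)) x = _ :=
    (h3.congr_of_eventuallyEq h1).fderiv
  rw [InnerProductSpace.laplacian_eq_iteratedFDeriv_stdOrthonormalBasis]
  have key : ∀ i, iteratedFDeriv ℝ 2 (fun y : E => u ‖y‖) x
      ![(stdOrthonormalBasis ℝ E) i, (stdOrthonormalBasis ℝ E) i] =
      ((u'' * ‖x‖ - u' ‖x‖) / ‖x‖ ^ 3) * (inner ℝ x (stdOrthonormalBasis ℝ E i) *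
        inner ℝ (stdOrthonormalBasis ℝ E i) x) + u' ‖x‖ / ‖x‖ := by
    intro i
    have hi : inner ℝ (stdOrthonormalBasis ℝ E i) (stdOrthonormalBasis ℝ E i) = (1 : ℝ) := by
      simp
    have e : ∀ y z : E, innerSL ℝ y z = inner ℝ y z := fun y z => rfl
    rw [iteratedFDeriv_two_apply, h4]
    simp only [add_apply, smul_apply,
      ContinuousLinearMap.smulRight_apply, Matrix.cons_val_zero, Matrix.cons_val_one,
      smul_eq_mul, mul_one]
    rw [e, e, hi, real_inner_comm x]
    field_simp
    ring
  simp only [key, Finset.sum_add_distrib, ← Finset.mul_sum]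
  rw [OrthonormalBasis.sum_inner_mul_inner, real_inner_self_eq_norm_sq]
  simp
  field_simp
  ring

end Radial

/-- With `w = r^(1-2ρ) u'`, the radial equation on `(0, R)` is the first order system
`u' = r^(2ρ-1) w`, `w' = r^(β-1) u^q |w|^m`. -/
structure RadialSystem (rho m q theta R : ℝ) (u w : ℝ → ℝ) : Prop where
  pos : ∀ r ∈ Ioo 0 R, 0 < u r
  hasDerivAt_u : ∀ r ∈ Ioo 0 R, HasDerivAt u (r ^ (2 * rho - 1) * w r) r
  hasDerivAt_w : ∀ r ∈ Ioo 0 R,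
    HasDerivAt w (r ^ (beta rho m q theta - 1) * u r ^ q * |w r| ^ m) r

theorem beta_eq {rho m q theta : ℝ} (hk : 0 < kappa m q) :
    beta rho m q theta = theta + 2 - m + 2 * rho * (m - 1) := by
  rw [beta, bigTheta, mul_div_cancel₀ _ hk.ne']

/-- The radial equation in the form `u'' + (1 - 2ρ) u' / r = r^θ u^q |u'|^m`. -/
theorem radial_equation_iff {N : ℕ} {rho theta m q R : ℝ} {u u' u'' : ℝ → ℝ}
    {x : EuclideanSpace ℝ (Fin N)} (hx : x ∈ puncturedBall N R)
    (hu : ∀ r ∈ Ioo 0 R, HasDerivAt u (u' r) r) (hu' : ∀ r ∈ Ioo 0 R, HasDerivAt u' (u'' r) r) :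
    (Laplacian.laplacian (fun y : EuclideanSpace ℝ (Fin N) => u ‖y‖) x
        + (2 - (N : ℝ) - 2 * rho) *
          (inner ℝ x (gradient (fun y : EuclideanSpace ℝ (Fin N) => u ‖y‖) x) / ‖x‖ ^ 2)
        + 0 / ‖x‖ ^ 2 * u ‖x‖
      = ‖x‖ ^ theta * u ‖x‖ ^ q *
        ‖gradient (fun y : EuclideanSpace ℝ (Fin N) => u ‖y‖) x‖ ^ m) ↔
    u'' ‖x‖ + (1 - 2 * rho) * (u' ‖x‖ / ‖x‖) = ‖x‖ ^ theta * u ‖x‖ ^ q * |u' ‖x‖| ^ m := by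
  have hx0 : x ≠ 0 := hx.2
  have hn : ‖x‖ ≠ 0 := norm_ne_zero_iff.2 hx0
  have hr : ‖x‖ ∈ Ioo 0 R := ⟨norm_pos_iff.2 hx0, by simpa using hx.1⟩
  rw [laplacian_radial hx0 (Filter.eventually_of_mem (isOpen_Ioo.mem_nhds hr) hu) (hu' _ hr),
    gradient_radial hx0 (hu _ hr), norm_smul, inner_smul_right, real_inner_self_eq_norm_sq]
  have e1 : ‖u' ‖x‖ / ‖x‖‖ * ‖x‖ = |u' ‖x‖| := by
    rw [norm_div, norm_norm, Real.norm_eq_abs]; field_simp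
  rw [e1]
  simp only [finrank_euclideanSpace, Fintype.card_fin, zero_div, zero_mul, add_zero]
  have e2 : u'' ‖x‖ + (N - 1) * (u' ‖x‖ / ‖x‖) +
      (2 - (N : ℝ) - 2 * rho) * (u' ‖x‖ / ‖x‖ * ‖x‖ ^ 2 / ‖x‖ ^ 2) =
      u'' ‖x‖ + (1 - 2 * rho) * (u' ‖x‖ / ‖x‖) := by
    field_simp; ring
  rw [e2]

theorem exists_norm_eq {N : ℕ} (hN : 2 ≤ N) :
    ∃ e : EuclideanSpace ℝ (Fin N), ‖e‖ = 1 :=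
  ⟨EuclideanSpace.single ⟨0, by omega⟩ 1, by simp⟩

/-- The profile of a radial solution is recovered along a ray, which also transfers its
regularity. -/
theorem exists_radialSystem {N : ℕ} (hN : 2 ≤ N) {rho theta m q R : ℝ} {u : ℝ → ℝ}
    (hk : 0 < kappa m q)
    (h : IsPositiveRadialSolution N rho 0 theta m q R u) :
    ∃ w, RadialSystem rho m q theta R u w := by
  obtain ⟨e, he⟩ := exists_norm_eq hN
  obtain ⟨hpos, hC, heq⟩ := h
  have hmem : ∀ r ∈ Ioo 0 R, r • e ∈ puncturedBall N R := by
    intro r hr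
    have : ‖r • e‖ = r := by simp [norm_smul, he, abs_of_pos hr.1]
    refine ⟨by simpa [this] using hr.2, fun h0 => ?_⟩
    rw [mem_singleton_iff] at h0
    rw [h0, norm_zero] at this
    exact hr.1.ne this
  have hnorm : ∀ r ∈ Ioo 0 R, ‖r • e‖ = r := fun r hr => by
    simp [norm_smul, he, abs_of_pos hr.1]
  have hu2 : ContDiffOn ℝ 2 u (Ioo 0 R) := by
    have := hC.comp (t := puncturedBall N R) (s := Ioo 0 R) (f := fun r : ℝ => r • e)
      (by fun_prop) hmem
    refine this.congr fun r hr => ?_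
    simp only [Function.comp]
    rw [hnorm r hr]
  have hd : ContDiffOn ℝ 1 (deriv u) (Ioo 0 R) :=
    ((contDiffOn_succ_iff_deriv_of_isOpen (n := 1) isOpen_Ioo).1
      (by rw [one_add_one_eq_two]; exact hu2)).2.2
  have hu : ∀ r ∈ Ioo 0 R, HasDerivAt u (deriv u r) r := fun r hr =>
    ((hu2.differentiableOn (by simp)).differentiableAt (isOpen_Ioo.mem_nhds hr)).hasDerivAt
  have hu' : ∀ r ∈ Ioo 0 R, HasDerivAt (deriv u) (deriv (deriv u) r) r := fun r hr =>
    ((hd.differentiableOn (by simp)).differentiableAt (isOpen_Ioo.mem_nhds hr)).hasDerivAt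
  refine ⟨fun r => r ^ (1 - 2 * rho) * deriv u r, hpos, fun r hr => ?_, fun r hr => ?_⟩
  · convert hu r hr using 1
    rw [← mul_assoc, ← Real.rpow_add hr.1]
    simp
  · have h1 := (radial_equation_iff (rho := rho) (theta := theta) (m := m) (q := q)
      (hmem r hr) hu hu').1 (heq _ (hmem r hr))
    rw [hnorm r hr] at h1
    have h2 := (Real.hasDerivAt_rpow_const (x := r) (p := 1 - 2 * rho) (.inl hr.1.ne')).mul
      (hu' r hr)
    refine h2.congr_deriv ?_
    have hr0 := hr.1
    rw [abs_mul, abs_of_pos (Real.rpow_pos_of_pos hr0 _),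
      Real.mul_rpow (by positivity) (abs_nonneg _), ← Real.rpow_mul hr0.le]
    have e1 : r ^ (beta rho m q theta - 1) * u r ^ q * (r ^ ((1 - 2 * rho) * m) * |deriv u r| ^ m)
        = (r ^ (beta rho m q theta - 1) * r ^ ((1 - 2 * rho) * m)) *
          (u r ^ q * |deriv u r| ^ m) := by ring
    have e2 : r ^ (1 - 2 * rho - 1) = r ^ (1 - 2 * rho) / r := by
      rw [Real.rpow_sub hr0, Real.rpow_one]
    rw [e1, ← Real.rpow_add hr0, beta_eq hk, e2]
    have e3 : theta + 2 - m + 2 * rho * (m - 1) - 1 + (1 - 2 * rho) * m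
        = (1 - 2 * rho) + theta := by ring
    rw [e3, Real.rpow_add hr0]
    linear_combination r ^ (1 - 2 * rho) * h1

theorem RadialSystem.isPositiveRadialSolution {N : ℕ} {rho theta m q R : ℝ}
    {u w : ℝ → ℝ} (hm : 0 < m) (hk : 0 < kappa m q) (h : RadialSystem rho m q theta R u w) :
    IsPositiveRadialSolution N rho 0 theta m q R u := by
  have hwc : ∀ r ∈ Ioo 0 R, ContinuousAt w r := fun r hr => (h.hasDerivAt_w r hr).continuousAt
  have huc : ∀ r ∈ Ioo 0 R, ContinuousAt u r := fun r hr => (h.hasDerivAt_u r hr).continuousAt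
  have hw' : ∀ r ∈ Ioo 0 R,
      deriv w r = r ^ (beta rho m q theta - 1) * u r ^ q * |w r| ^ m := fun r hr =>
    (h.hasDerivAt_w r hr).deriv
  have hw1 : ContDiffOn ℝ 1 w (Ioo 0 R) := by
    rw [show (1 : WithTop ℕ∞) = 0 + 1 by simp, contDiffOn_succ_iff_deriv_of_isOpen isOpen_Ioo]
    refine ⟨fun r hr => (h.hasDerivAt_w r hr).differentiableAt.differentiableWithinAt,
      by simp, contDiffOn_zero.2 ?_⟩
    refine ContinuousOn.congr (f := fun r => r ^ (beta rho m q theta - 1) * u r ^ q * |w r| ^ m)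
      (fun r hr => ContinuousAt.continuousWithinAt ?_) hw'
    refine ((Real.continuousAt_rpow_const _ _ (.inl hr.1.ne')).mul
      ((huc r hr).rpow_const (.inl (h.pos r hr).ne'))).mul
      ((hwc r hr).abs.rpow_const (.inr hm.le))
  have hu2 : ContDiffOn ℝ 2 u (Ioo 0 R) := by
    rw [show (2 : WithTop ℕ∞) = 1 + 1 by norm_num, contDiffOn_succ_iff_deriv_of_isOpen isOpen_Ioo]
    refine ⟨fun r hr => (h.hasDerivAt_u r hr).differentiableAt.differentiableWithinAt,
      by simp, ?_⟩
    refine ContDiffOn.congr (f := fun r => r ^ (2 * rho - 1) * w r) ?_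
      (fun r hr => (h.hasDerivAt_u r hr).deriv)
    exact ContDiffOn.mul (fun r hr => (Real.contDiffAt_rpow_const_of_ne hr.1.ne').contDiffWithinAt)
      hw1
  have hnorm : ∀ x ∈ puncturedBall N R, ‖x‖ ∈ Ioo 0 R := fun x hx =>
    ⟨norm_pos_iff.2 hx.2, by simpa using hx.1⟩
  refine ⟨h.pos, ?_, fun x hx => ?_⟩
  · refine hu2.comp (t := Ioo 0 R) (s := puncturedBall N R)
      (fun x hx => (contDiffAt_norm ℝ hx.2).contDiffWithinAt) hnorm
  · have h2 : ∀ r ∈ Ioo 0 R, HasDerivAt (fun r => r ^ (2 * rho - 1) * w r)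
      ((2 * rho - 1) * r ^ (2 * rho - 1 - 1) * w r + r ^ (2 * rho - 1) *
        (r ^ (beta rho m q theta - 1) * u r ^ q * |w r| ^ m)) r := fun r hr =>
      (Real.hasDerivAt_rpow_const (.inl hr.1.ne')).mul (h.hasDerivAt_w r hr)
    refine (radial_equation_iff hx h.hasDerivAt_u h2).2 ?_
    generalize hr : ‖x‖ = r
    have hr0 : 0 < r := hr ▸ (hnorm x hx).1
    rw [abs_mul, abs_of_pos (Real.rpow_pos_of_pos hr0 _),
      Real.mul_rpow (by positivity) (abs_nonneg _), ← Real.rpow_mul hr0.le]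
    have e1 : r ^ (2 * rho - 1) * (r ^ (beta rho m q theta - 1) * u r ^ q * |w r| ^ m)
        = (r ^ (2 * rho - 1) * r ^ (beta rho m q theta - 1)) * (u r ^ q * |w r| ^ m) := by ring
    have e2 : r ^ (2 * rho - 1 - 1) = r ^ (2 * rho - 1) / r := by
      rw [Real.rpow_sub hr0, Real.rpow_one]
    have e3 : 2 * rho - 1 + (theta + 2 - m + 2 * rho * (m - 1) - 1)
        = theta + (2 * rho - 1) * m := by ring
    rw [e1, ← Real.rpow_add hr0, beta_eq hk, e2, e3, Real.rpow_add hr0]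
    ring

/-- `r^* = 0` means that `u` is not constantly `γ` on any interval `(0, r)`. -/
theorem rStar_eq_zero_iff {gam R : ℝ} {u : ℝ → ℝ} :
    rStar gam R u = 0 ↔ ∀ r ∈ Ioo 0 R, ∃ s ∈ Ioo 0 r, u s ≠ gam := by
  constructor
  · intro h r hr
    by_contra! hc
    have : r ≤ rStar gam R u := le_csSup ⟨R, fun s hs => hs.1.2.le⟩ ⟨hr, hc⟩
    linarith [hr.1]
  · intro h
    have : {r : ℝ | r ∈ Ioo 0 R ∧ ∀ s ∈ Ioo 0 r, u s = gam} = ∅ := by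
      ext r
      simp only [mem_ofPred_eq, mem_empty_iff_false, iff_false, not_and]
      intro hr hc
      obtain ⟨s, hs, hne⟩ := h r hr
      exact hne (hc s hs)
    rw [rStar, this, Real.sSup_empty]

/-! ### Integration of power asymptotics at the origin -/

section PowerAsymptotics

theorem eventually_nhdsGT_zero_iff {P : ℝ → Prop} :
    (∀ᶠ r in 𝓝[>] (0 : ℝ), P r) ↔ ∃ δ, 0 < δ ∧ ∀ r ∈ Ioo 0 δ, P r := by
  rw [Filter.Eventually, mem_nhdsGT_iff_exists_Ioo_subset]
  rfl

theorem monotoneOn_Ioo_of_hasDerivAt {f f' : ℝ → ℝ} {a b : ℝ}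
    (hf : ∀ r ∈ Ioo a b, HasDerivAt f (f' r) r) (hf' : ∀ r ∈ Ioo a b, 0 ≤ f' r) :
    MonotoneOn f (Ioo a b) :=
  monotoneOn_of_hasDerivWithinAt_nonneg (convex_Ioo a b)
    (fun r hr => (hf r hr).continuousAt.continuousWithinAt)
    (fun r hr => (hf r (interior_subset hr)).hasDerivWithinAt)
    (fun r hr => hf' r (interior_subset hr))

theorem hasDerivAt_const_mul_rpow {p K r : ℝ} (hp : p ≠ 0) (hr : 0 < r) :
    HasDerivAt (fun x => K / p * x ^ p) (K * r ^ (p - 1)) r := by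
  have := (Real.hasDerivAt_rpow_const (p := p) (.inl hr.ne')).const_mul (K / p)
  refine this.congr_deriv ?_
  field_simp

theorem abs_sub_le_of_abs_deriv_le_rpow {f f' : ℝ → ℝ} {p C δ : ℝ} (hp : p ≠ 0)
    (hf : ∀ r ∈ Ioo 0 δ, HasDerivAt f (f' r) r) (hf' : ∀ r ∈ Ioo 0 δ, |f' r| ≤ C * r ^ (p - 1))
    {r s : ℝ} (hr : r ∈ Ioo 0 δ) (hs : s ∈ Ioo 0 δ) (hrs : r ≤ s) :
    |f s - f r| ≤ C / p * (s ^ p - r ^ p) := by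
  have hpow : ∀ x ∈ Ioo 0 δ, HasDerivAt (fun x => C / p * x ^ p) (C * x ^ (p - 1)) x :=
    fun x hx => hasDerivAt_const_mul_rpow hp hx.1
  have h1 := monotoneOn_Ioo_of_hasDerivAt (fun x hx => (hpow x hx).add (hf x hx))
    (fun x hx => by linarith [neg_le_of_abs_le (hf' x hx)]) hr hs hrs
  have h2 := monotoneOn_Ioo_of_hasDerivAt (fun x hx => (hpow x hx).sub (hf x hx))
    (fun x hx => by linarith [le_of_abs_le (hf' x hx)]) hr hs hrs
  simp only [Pi.add_apply, Pi.sub_apply] at h1 h2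
  rw [abs_le]
  constructor <;> linarith

theorem tendsto_rpow_nhdsGT_zero {p : ℝ} (hp : 0 < p) :
    Tendsto (fun r : ℝ => r ^ p) (𝓝[>] 0) (𝓝 0) := by
  have := (Real.continuousAt_rpow_const 0 p (.inr hp.le)).tendsto
  rw [Real.zero_rpow hp.ne'] at this
  exact this.mono_left nhdsWithin_le_nhds

theorem tendsto_rpow_neg_nhdsGT_zero {p : ℝ} (hp : p < 0) :
    Tendsto (fun r : ℝ => r ^ p) (𝓝[>] 0) atTop := by
  have h2 : Tendsto (fun r : ℝ => r ^ (-p)) (𝓝[>] 0) (𝓝[>] 0) :=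
    tendsto_nhdsWithin_iff.2 ⟨tendsto_rpow_nhdsGT_zero (neg_pos.2 hp), by
      filter_upwards [self_mem_nhdsWithin] with r hr using Real.rpow_pos_of_pos hr _⟩
  refine h2.inv_tendsto_nhdsGT_zero.congr' ?_
  filter_upwards [self_mem_nhdsWithin] with r hr
  rw [Pi.inv_apply, ← Real.rpow_neg (le_of_lt hr), neg_neg]

variable {f f' : ℝ → ℝ} {p : ℝ}

/-- A function whose derivative is dominated by an integrable power has a limit at `0`. -/
theorem exists_tendsto_of_deriv_isBigO_rpow (hp : 0 < p)
    (hf : ∀ᶠ r in 𝓝[>] 0, HasDerivAt f (f' r) r)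
    (hf' : f' =O[𝓝[>] 0] fun r => r ^ (p - 1)) : ∃ l, Tendsto f (𝓝[>] 0) (𝓝 l) := by
  obtain ⟨C, hC0, hC⟩ := hf'.exists_pos
  obtain ⟨δ, hδ, h⟩ := eventually_nhdsGT_zero_iff.1 (hf.and hC.bound)
  have hb : ∀ r ∈ Ioo 0 δ, |f' r| ≤ C * r ^ (p - 1) := fun r hr => by
    simpa [abs_of_pos (Real.rpow_pos_of_pos hr.1 _)] using (h r hr).2
  refine cauchy_map_iff_exists_tendsto.1 ((Metric.cauchy_iff).2 ⟨inferInstance, fun ε hε => ?_⟩)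
  have ht : ∀ᶠ r in 𝓝[>] (0 : ℝ), C / p * r ^ p < ε := by
    have := (tendsto_rpow_nhdsGT_zero hp).const_mul (C / p)
    rw [mul_zero] at this
    exact this.eventually_lt_const hε
  obtain ⟨δ', hδ', h'⟩ := eventually_nhdsGT_zero_iff.1 ht
  refine ⟨f '' Ioo 0 (min δ δ'), image_mem_map (Ioo_mem_nhdsGT (lt_min hδ hδ')), ?_⟩
  have key : ∀ r ∈ Ioo 0 (min δ δ'), ∀ s ∈ Ioo 0 (min δ δ'), r ≤ s → |f s - f r| < ε := by
    intro r hr s hs hrs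
    have := abs_sub_le_of_abs_deriv_le_rpow hp.ne' (fun r hr => (h r hr).1) hb
      ⟨hr.1, hr.2.trans_le (min_le_left _ _)⟩ ⟨hs.1, hs.2.trans_le (min_le_left _ _)⟩ hrs
    have h2 := h' s ⟨hs.1, hs.2.trans_le (min_le_right _ _)⟩
    have h3 : 0 ≤ C / p * r ^ p := mul_nonneg (by positivity) (Real.rpow_nonneg hr.1.le _)
    linarith
  rintro _ ⟨r, hr, rfl⟩ _ ⟨s, hs, rfl⟩
  rw [Real.dist_eq]
  rcases le_total r s with hrs | hrs
  · rw [abs_sub_comm]; exact key r hr s hs hrs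
  · exact key s hs r hr hrs

theorem isBigOWith_sub_of_deriv {C l : ℝ} (hp : 0 < p)
    (hf : ∀ᶠ r in 𝓝[>] 0, HasDerivAt f (f' r) r) (hl : Tendsto f (𝓝[>] 0) (𝓝 l))
    (hf' : IsBigOWith C (𝓝[>] 0) f' fun r => r ^ (p - 1)) (hC : 0 ≤ C) :
    IsBigOWith (C / p) (𝓝[>] 0) (fun r => f r - l) fun r => r ^ p := by
  obtain ⟨δ, hδ, h⟩ := eventually_nhdsGT_zero_iff.1 (hf.and hf'.bound)
  have hb : ∀ r ∈ Ioo 0 δ, |f' r| ≤ C * r ^ (p - 1) := fun r hr => by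
    simpa [abs_of_pos (Real.rpow_pos_of_pos hr.1 _)] using (h r hr).2
  refine IsBigOWith.of_bound (eventually_nhdsGT_zero_iff.2 ⟨δ, hδ, fun s hs => ?_⟩)
  rw [Real.norm_eq_abs, Real.norm_eq_abs, abs_of_pos (Real.rpow_pos_of_pos hs.1 _)]
  refine le_of_tendsto (hl.const_sub (f s)).abs ?_
  filter_upwards [Ioo_mem_nhdsGT hs.1] with r hr
  have := abs_sub_le_of_abs_deriv_le_rpow hp.ne' (fun r hr => (h r hr).1) hb
    ⟨hr.1, hr.2.trans hs.2⟩ hs hr.2.le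
  have h3 : 0 ≤ C / p * r ^ p := mul_nonneg (by positivity) (Real.rpow_nonneg hr.1.le _)
  linarith

theorem isBigO_sub_of_deriv {l : ℝ} (hp : 0 < p)
    (hf : ∀ᶠ r in 𝓝[>] 0, HasDerivAt f (f' r) r) (hl : Tendsto f (𝓝[>] 0) (𝓝 l))
    (hf' : f' =O[𝓝[>] 0] fun r => r ^ (p - 1)) :
    (fun r => f r - l) =O[𝓝[>] 0] fun r => r ^ p := by
  obtain ⟨C, hC0, hC⟩ := hf'.exists_nonneg
  exact (isBigOWith_sub_of_deriv hp hf hl hC hC0).isBigO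

theorem isLittleO_sub_of_deriv {l : ℝ} (hp : 0 < p)
    (hf : ∀ᶠ r in 𝓝[>] 0, HasDerivAt f (f' r) r) (hl : Tendsto f (𝓝[>] 0) (𝓝 l))
    (hf' : f' =o[𝓝[>] 0] fun r => r ^ (p - 1)) :
    (fun r => f r - l) =o[𝓝[>] 0] fun r => r ^ p := by
  refine IsLittleO.of_isBigOWith fun c hc => ?_
  have := isBigOWith_sub_of_deriv hp hf hl (hf'.forall_isBigOWith (mul_pos hc hp))
    (mul_pos hc hp).le
  rwa [mul_div_cancel_right₀ _ hp.ne'] at this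

theorem isLittleO_of_deriv_of_neg (hp : p < 0)
    (hf : ∀ᶠ r in 𝓝[>] 0, HasDerivAt f (f' r) r)
    (hf' : f' =o[𝓝[>] 0] fun r => r ^ (p - 1)) : f =o[𝓝[>] 0] fun r => r ^ p := by
  refine IsLittleO.of_bound fun c hc => ?_
  have hC := hf'.def (mul_pos (half_pos hc) (neg_pos.2 hp))
  obtain ⟨δ, hδ, h⟩ := eventually_nhdsGT_zero_iff.1 (hf.and hC)
  have hb : ∀ r ∈ Ioo 0 δ, |f' r| ≤ (c / 2 * -p) * r ^ (p - 1) := fun r hr => by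
    simpa [abs_of_pos (Real.rpow_pos_of_pos hr.1 _)] using (h r hr).2
  have hs : δ / 2 ∈ Ioo 0 δ := ⟨by linarith, by linarith⟩
  have ht := (tendsto_rpow_neg_nhdsGT_zero hp).eventually_ge_atTop (|f (δ / 2)| * (2 / c))
  filter_upwards [Ioo_mem_nhdsGT hs.1, ht] with r hr hr2
  have h1 := abs_sub_le_of_abs_deriv_le_rpow hp.ne (fun r hr => (h r hr).1) hb
    ⟨hr.1, hr.2.trans hs.2⟩ hs hr.2.le
  have h2 : c / 2 * -p / p = - (c / 2) := by have := hp.ne; field_simp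
  rw [h2] at h1
  have h3 : |f (δ / 2)| ≤ c / 2 * r ^ p := by
    calc |f (δ / 2)| = c / 2 * (|f (δ / 2)| * (2 / c)) := by field_simp
      _ ≤ _ := by gcongr
  have h4 : 0 < (δ / 2) ^ p := Real.rpow_pos_of_pos hs.1 _
  have h5 : |f r| ≤ |f (δ / 2)| + |f (δ / 2) - f r| := by
    have := abs_sub_abs_le_abs_sub (f r) (f (δ / 2))
    rw [abs_sub_comm (f r)] at this
    linarith
  rw [Real.norm_eq_abs, Real.norm_eq_abs, abs_of_pos (Real.rpow_pos_of_pos hr.1 _)]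
  nlinarith

/-- Integration of a power asymptotic with positive exponent, from the limit at `0`. -/
theorem isEquivalent_sub_of_deriv {K l : ℝ} (hp : 0 < p) (hK : K ≠ 0)
    (hf : ∀ᶠ r in 𝓝[>] 0, HasDerivAt f (f' r) r) (hl : Tendsto f (𝓝[>] 0) (𝓝 l))
    (hf' : f' ~[𝓝[>] 0] fun r => K * r ^ (p - 1)) :
    (fun r => f r - l) ~[𝓝[>] 0] fun r => K / p * r ^ p := by
  have hKp : K / p ≠ 0 := div_ne_zero hK hp.ne'
  have h := isLittleO_sub_of_deriv (f := fun r => f r - K / p * r ^ p)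
    (f' := fun r => f' r - K * r ^ (p - 1)) (l := l) hp ?_ ?_
    ((isLittleO_const_mul_right_iff hK).1 hf'.isLittleO)
  · refine ((isLittleO_const_mul_right_iff hKp).2 h).congr_left fun r => ?_
    simp only [Pi.sub_apply]
    ring
  · filter_upwards [hf, self_mem_nhdsWithin] with r h1 h2
    exact h1.sub (hasDerivAt_const_mul_rpow hp.ne' h2)
  · simpa using hl.sub ((tendsto_rpow_nhdsGT_zero hp).const_mul (K / p))

/-- Integration of a power asymptotic with negative exponent. -/
theorem isEquivalent_of_deriv_of_neg {K : ℝ} (hp : p < 0) (hK : K ≠ 0)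
    (hf : ∀ᶠ r in 𝓝[>] 0, HasDerivAt f (f' r) r)
    (hf' : f' ~[𝓝[>] 0] fun r => K * r ^ (p - 1)) :
    f ~[𝓝[>] 0] fun r => K / p * r ^ p := by
  have hKp : K / p ≠ 0 := div_ne_zero hK hp.ne
  have h := isLittleO_of_deriv_of_neg (f := fun r => f r - K / p * r ^ p)
    (f' := fun r => f' r - K * r ^ (p - 1)) hp ?_
    ((isLittleO_const_mul_right_iff hK).1 hf'.isLittleO)
  · exact (isLittleO_const_mul_right_iff hKp).2 h
  · filter_upwards [hf, self_mem_nhdsWithin] with r h1 h2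
    exact h1.sub (hasDerivAt_const_mul_rpow hp.ne h2)

/-- A function whose derivative is at least `c / r` near `0` decreases to `-∞` at `0`, since `1 / r`
is not integrable there. -/
theorem not_tendsto_of_le_mul_deriv {c l : ℝ} (hc : 0 < c)
    (hf : ∀ᶠ r in 𝓝[>] 0, HasDerivAt f (f' r) r) (hf' : ∀ᶠ r in 𝓝[>] 0, c ≤ r * f' r) :
    ¬ Tendsto f (𝓝[>] 0) (𝓝 l) := by
  intro hl
  obtain ⟨δ, hδ, h⟩ := eventually_nhdsGT_zero_iff.1 (hf.and hf')
  have hmono : MonotoneOn (fun r => f r - c * Real.log r) (Ioo 0 δ) := by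
    refine monotoneOn_Ioo_of_hasDerivAt (fun r hr => (h r hr).1.sub
      ((Real.hasDerivAt_log hr.1.ne').const_mul c)) fun r hr => ?_
    have h1 := (h r hr).2
    have hr0 := hr.1
    rw [sub_nonneg, ← div_eq_mul_inv, div_le_iff₀ hr0, mul_comm]
    exact h1
  have hs : δ / 2 ∈ Ioo 0 δ := ⟨by linarith, by linarith⟩
  have ht : Tendsto (fun r => f r - c * Real.log r) (𝓝[>] 0) atTop := by
    refine hl.add_atTop (tendsto_neg_atBot_atTop.comp
      (Real.tendsto_log_nhdsGT_zero.const_mul_atBot hc))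
  obtain ⟨r, hr, hr'⟩ := ((show ∀ᶠ r in 𝓝[>] 0, r ∈ Ioo 0 (δ / 2) from
    Ioo_mem_nhdsGT hs.1).and (ht.eventually_gt_atTop
    (f (δ / 2) - c * Real.log (δ / 2)))).exists
  exact absurd (hmono ⟨hr.1, hr.2.trans hs.2⟩ hs hr.2.le) (not_le.2 hr')

/-- If `f'` is asymptotic to a multiple of `r ^ (p - 1)` and `f` converges at `0`, then `p > 0`. -/
theorem exponent_pos_of_deriv_isEquivalent {K l : ℝ} (hK : K ≠ 0)
    (hf : ∀ᶠ r in 𝓝[>] 0, HasDerivAt f (f' r) r) (hl : Tendsto f (𝓝[>] 0) (𝓝 l))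
    (hf' : f' ~[𝓝[>] 0] fun r => K * r ^ (p - 1)) : 0 < p := by
  by_contra! hp
  wlog hK0 : 0 < K generalizing f f' K l
  · refine this (f := fun r => - f r) (f' := fun r => - f' r) (neg_ne_zero.2 hK)
      (hf.mono fun r hr => hr.neg) hl.neg ?_ (by
        have := lt_of_le_of_ne (not_lt.1 hK0) hK
        linarith)
    refine hf'.neg.congr_right (.of_forall fun r => ?_)
    simp
  -- for `p ≤ 0` the derivative is at least `(K / 2) / r` near `0`
  refine not_tendsto_of_le_mul_deriv (c := K / 2) (by positivity) hf ?_ hl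
  have h1 := hf'.isLittleO.def (c := 1 / 2) (by norm_num)
  filter_upwards [h1, Ioo_mem_nhdsGT (zero_lt_one' ℝ)] with r hr hr1
  have h2 : 0 < r ^ (p - 1) := Real.rpow_pos_of_pos hr1.1 _
  simp only [Pi.sub_apply, Real.norm_eq_abs, abs_of_pos (mul_pos hK0 h2)] at hr
  have h3 : K / 2 * r ^ (p - 1) ≤ f' r := by linarith [neg_le_of_abs_le hr]
  have h4 : 1 ≤ r ^ p := Real.one_le_rpow_of_pos_of_le_one_of_nonpos hr1.1 hr1.2.le hp
  have h5 : r * r ^ (p - 1) = r ^ p := by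
    rw [Real.rpow_sub hr1.1, Real.rpow_one, mul_div_cancel₀ _ hr1.1.ne']
  calc K / 2 ≤ K / 2 * r ^ p := by nlinarith
    _ = r * (K / 2 * r ^ (p - 1)) := by rw [← h5]; ring
    _ ≤ r * f' r := by have := hr1.1; gcongr

end PowerAsymptotics

/-! ### Asymptotics of solutions: separation of variables -/

section Primitives

theorem neg_of_sign_eq_neg_one {x : ℝ} (h : Real.sign x = -1) : x < 0 := by
  rcases lt_trichotomy x 0 with h1 | h1 | h1
  · exact h1
  · rw [h1, Real.sign_zero] at h; norm_num at h
  · rw [Real.sign_of_pos h1] at h; norm_num at h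

theorem pos_of_sign_eq_one {x : ℝ} (h : Real.sign x = 1) : 0 < x := by
  rcases lt_trichotomy x 0 with h1 | h1 | h1
  · rw [Real.sign_of_neg h1] at h; norm_num at h
  · rw [h1, Real.sign_zero] at h; norm_num at h
  · exact h1

/-- On a set where `w` has sign `σ`, the equation `w' = a |w|^m` is separable: `a` is the derivative
of `|w|^(1-m) sgn w / (1-m)`. -/
theorem hasDerivAt_power_primitive {w : ℝ → ℝ} {a m σ r : ℝ} (hσ : σ = 1 ∨ σ = -1) (hm1 : m ≠ 1)
    (hw : 0 < σ * w r) (h : HasDerivAt w (a * |w r| ^ m) r) :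
    HasDerivAt (fun x => σ * ((σ * w x) ^ (1 - m) / (1 - m))) a r := by
  have h1 : 1 - m ≠ 0 := sub_ne_zero.2 hm1.symm
  have hab : |w r| = σ * w r := by
    rw [← abs_of_pos hw, abs_mul]
    rcases hσ with rfl | rfl <;> simp
  have h2 := (((h.const_mul σ).rpow_const (p := 1 - m)
    (.inl hw.ne')).div_const (1 - m)).const_mul σ
  refine h2.congr_deriv ?_
  rw [hab, show 1 - m - 1 = -m by ring, Real.rpow_neg hw.le]
  have h3 := (Real.rpow_pos_of_pos hw m).ne'
  have h4 : σ * σ = 1 := by rcases hσ with rfl | rfl <;> norm_num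
  generalize (σ * w r) ^ m = A at *
  field_simp
  linear_combination h4 * a

/-- The analogue of `hasDerivAt_power_primitive` for `m = 1`. -/
theorem hasDerivAt_log_primitive {w : ℝ → ℝ} {a σ r : ℝ} (hσ : σ = 1 ∨ σ = -1)
    (hw : 0 < σ * w r) (h : HasDerivAt w (a * |w r| ^ (1 : ℝ)) r) :
    HasDerivAt (fun x => σ * Real.log (σ * w x)) a r := by
  have hab : |w r| = σ * w r := by
    rw [← abs_of_pos hw, abs_mul]
    rcases hσ with rfl | rfl <;> simp
  have h2 := (((h.const_mul σ).log hw.ne')).const_mul σ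
  refine h2.congr_deriv ?_
  rw [Real.rpow_one, hab]
  have h4 : σ * σ = 1 := by rcases hσ with rfl | rfl <;> norm_num
  have h5 := hw.ne'
  have h6 : σ ≠ 0 := by rintro rfl; simp at h4
  have h7 : w r ≠ 0 := by intro h; simp [h] at hw
  field_simp
  linear_combination h4 * a

/-- If the primitive `|w|^(1-m) sgn w / (1-m)` is asymptotic to `G r^b / b`, then `w` is asymptotic
to a multiple of `r^e` with `e = b / (1-m)`, and the sign of `w` is that of `e`. -/
theorem isEquivalent_of_power_primitive {w : ℝ → ℝ} {m b G σ : ℝ} (hσ : σ = 1 ∨ σ = -1)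
    (hm1 : m ≠ 1) (hb : b ≠ 0) (hG : 0 < G) (hw : ∀ᶠ r in 𝓝[>] 0, 0 < σ * w r)
    (hφ : (fun r => σ * ((σ * w r) ^ (1 - m) / (1 - m))) ~[𝓝[>] 0] fun r => G / b * r ^ b) :
    w ~[𝓝[>] 0] fun r => Real.sign (b / (1 - m)) * (G / |b / (1 - m)|) ^ (1 / (1 - m)) *
      r ^ (b / (1 - m)) := by
  have h1 : 1 - m ≠ 0 := sub_ne_zero.2 hm1.symm
  obtain ⟨e, he⟩ : ∃ e, e = b / (1 - m) := ⟨_, rfl⟩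
  have hbe : b = e * (1 - m) := by rw [he]; field_simp
  have he0 : e ≠ 0 := by rw [he]; exact div_ne_zero hb h1
  have h4 : σ * σ = 1 := by rcases hσ with rfl | rfl <;> norm_num
  rw [← he]
  have h2 : (fun r => (σ * w r) ^ (1 - m)) ~[𝓝[>] 0] fun r => σ * G / e * r ^ b := by
    refine ((IsEquivalent.refl (u := fun _ : ℝ => σ * (1 - m))).mul hφ).congr_left
      (.of_forall fun r => ?_) |>.congr_right (.of_forall fun r => ?_)
    · simp only [Pi.mul_apply]
      field_simp
      linear_combination h4 * (σ * w r) ^ (1 - m)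
    · simp only [Pi.mul_apply]
      generalize r ^ b = B
      rw [hbe]
      field_simp
  have hpos : ∀ᶠ r in 𝓝[>] 0, 0 < σ * G / e * r ^ b :=
    h2.symm.eventually_pos (hw.mono fun r hr => Real.rpow_pos_of_pos hr _)
  have hσe : 0 < σ / e := by
    obtain ⟨r, hr, hr0⟩ := (hpos.and self_mem_nhdsWithin).exists
    have hB : 0 < r ^ b := Real.rpow_pos_of_pos hr0 _
    have : 0 < σ * G / e := pos_of_mul_pos_left hr hB.le
    rw [mul_comm, mul_div_assoc] at this
    exact pos_of_mul_pos_right this hG.le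
  have hsign : Real.sign e = σ := by
    rcases hσ with rfl | rfl
    · exact Real.sign_of_pos (one_div_pos.1 hσe)
    · refine Real.sign_of_neg ?_
      rcases lt_or_gt_of_ne he0 with h | h
      · exact h
      · have : (-1 : ℝ) / e < 0 := div_neg_of_neg_of_pos (by norm_num) h
        linarith
  have habs : |e| = σ * e := by
    rcases hσ with rfl | rfl
    · rw [one_mul, abs_of_pos (one_div_pos.1 hσe)]
    · rw [neg_one_mul, abs_of_neg (neg_of_sign_eq_neg_one hsign)]
  have hc : σ * G / e = G / |e| := by
    rw [habs]
    have hσ0 : σ ≠ 0 := by rintro rfl; simp at h4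
    field_simp
    linear_combination h4
  rw [hc] at h2
  have hGe : 0 < G / |e| := by positivity
  have h5 : (fun r => (σ * w r) ^ (1 - m)) ~[𝓝[>] 0] fun r => |G / |e| * r ^ b| := by
    refine h2.congr_right ?_
    filter_upwards [self_mem_nhdsWithin] with r hr
    rw [abs_of_pos (mul_pos hGe (Real.rpow_pos_of_pos hr _))]
  have h6 := h5.rpow (fun r => abs_nonneg _) (r := 1 / (1 - m))
  have h7 := (IsEquivalent.refl (u := fun _ : ℝ => σ)).mul h6
  refine (h7.congr_left ?_).congr_right ?_
  · filter_upwards [hw] with r hr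
    simp only [Pi.mul_apply, Pi.pow_apply]
    rw [← Real.rpow_mul hr.le, mul_one_div_cancel h1, Real.rpow_one, ← mul_assoc, h4, one_mul]
  · filter_upwards [self_mem_nhdsWithin] with r hr
    have hr0 : (0 : ℝ) < r := hr
    simp only [Pi.mul_apply, Pi.pow_apply]
    rw [abs_of_pos (mul_pos hGe (Real.rpow_pos_of_pos hr _)),
      Real.mul_rpow hGe.le (Real.rpow_nonneg hr0.le _), ← Real.rpow_mul hr0.le, hsign, mul_assoc,
      he, mul_one_div]

end Primitives

theorem zeta_sub {rho m q theta : ℝ} (hm1 : m ≠ 1) :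
    zeta m q theta - 2 * rho = beta rho m q theta / (1 - m) := by
  have h1 : 1 - m ≠ 0 := sub_ne_zero.2 hm1.symm
  rw [zeta, beta]
  field_simp
  ring

theorem caseII_of_zeta_pos {rho m q theta : ℝ} (hk : 0 < kappa m q) (hm1 : m ≠ 1)
    (hb : beta rho m q theta ≠ 0) (hz : 0 < zeta m q theta) : CaseII rho m q theta := by
  rw [zeta] at hz
  rcases div_pos_iff.1 hz with ⟨h1, h2⟩ | ⟨h1, h2⟩
  · have h3 := pos_of_mul_pos_right h1 hk.le
    exact ⟨hb, hm1, h3.ne', by rw [Real.sign_of_pos h3, Real.sign_of_pos h2]⟩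
  · have h3 : bigTheta m q theta < 0 := by
      by_contra! h
      exact absurd h1 (not_lt.2 (mul_nonneg hk.le h))
    exact ⟨hb, hm1, h3.ne, by rw [Real.sign_of_neg h3, Real.sign_of_neg h2]⟩

theorem CaseII.zeta_pos {rho m q theta : ℝ} (hk : 0 < kappa m q) (h : CaseII rho m q theta) :
    0 < zeta m q theta := by
  obtain ⟨-, hm1, hT, hs⟩ := h
  rw [zeta]
  rcases lt_or_gt_of_ne (sub_ne_zero.2 hm1.symm : 1 - m ≠ 0) with h | h
  · rw [Real.sign_of_neg h] at hs
    exact div_pos_of_neg_of_neg (mul_neg_of_pos_of_neg hk (neg_of_sign_eq_neg_one hs)) h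
  · rw [Real.sign_of_pos h] at hs
    exact div_pos (mul_pos hk (pos_of_sign_eq_one hs)) h

theorem weight_isEquivalent {b q gam : ℝ} {u : ℝ → ℝ} (hgam : 0 < gam)
    (hlim : Tendsto u (𝓝[>] 0) (𝓝 gam)) :
    (fun r => r ^ (b - 1) * u r ^ q) ~[𝓝[>] 0] fun r => gam ^ q * r ^ (b - 1) := by
  have h1 : (fun r => u r ^ q) ~[𝓝[>] 0] fun _ => gam ^ q :=
    (isEquivalent_const_iff_tendsto (Real.rpow_pos_of_pos hgam q).ne').2
      (hlim.rpow_const (.inl hgam.ne'))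
  refine ((IsEquivalent.refl (u := fun r : ℝ => r ^ (b - 1))).mul h1).congr_right ?_
  exact .of_forall fun r => mul_comm _ _

namespace RadialSystem

variable {rho m q theta gam R : ℝ} {u w : ℝ → ℝ}

theorem monotoneOn (h : RadialSystem rho m q theta R u w) : MonotoneOn w (Ioo 0 R) :=
  monotoneOn_Ioo_of_hasDerivAt h.hasDerivAt_w fun r hr =>
    mul_nonneg (mul_nonneg (Real.rpow_nonneg hr.1.le _) (Real.rpow_nonneg (h.pos r hr).le _))
      (Real.rpow_nonneg (abs_nonneg _) _)

/-- The monotone function `w` is positive everywhere or negative near `0`: a zero of a nonnegative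
`w` would make `w` vanish, hence `u` constant, to its left. -/
theorem pos_or_neg (h : RadialSystem rho m q theta R u w)
    (hlim : Tendsto u (𝓝[>] 0) (𝓝 gam)) (hne : ∀ r ∈ Ioo 0 R, ∃ s ∈ Ioo 0 r, u s ≠ gam) :
    (∀ r ∈ Ioo 0 R, 0 < w r) ∨ ∀ᶠ r in 𝓝[>] 0, w r < 0 := by
  by_cases hneg : ∃ r ∈ Ioo 0 R, w r < 0
  · obtain ⟨r, hr, hwr⟩ := hneg
    right
    filter_upwards [Ioo_mem_nhdsGT hr.1] with s hs
    exact (h.monotoneOn ⟨hs.1, hs.2.trans hr.2⟩ hr hs.2.le).trans_lt hwr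
  · push Not at hneg
    left
    intro r hr
    refine (hneg r hr).lt_of_ne fun h0 => ?_
    obtain ⟨s, hs, hus⟩ := hne r hr
    have hw0 : ∀ t ∈ Ioo 0 r, w t = 0 := fun t ht =>
      le_antisymm ((h.monotoneOn ⟨ht.1, ht.2.trans hr.2⟩ hr ht.2.le).trans_eq h0.symm)
        (hneg t ⟨ht.1, ht.2.trans hr.2⟩)
    have hd : ∀ t ∈ Ioo 0 r, HasDerivAt u 0 t := fun t ht => by
      simpa [hw0 t ht] using h.hasDerivAt_u t ⟨ht.1, ht.2.trans hr.2⟩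
    refine hus (tendsto_nhds_unique (tendsto_const_nhds.congr' ?_) hlim)
    filter_upwards [Ioo_mem_nhdsGT hr.1] with t ht
    exact isOpen_Ioo.is_const_of_deriv_eq_zero isPreconnected_Ioo
      (fun x hx => (hd x hx).differentiableAt.differentiableWithinAt)
      (fun x hx => (hd x hx).deriv) hs ht

theorem exists_sign (h : RadialSystem rho m q theta R u w) (hR : 0 < R)
    (hlim : Tendsto u (𝓝[>] 0) (𝓝 gam)) (hne : ∀ r ∈ Ioo 0 R, ∃ s ∈ Ioo 0 r, u s ≠ gam) :
    ∃ σ : ℝ, (σ = 1 ∨ σ = -1) ∧ ∀ᶠ r in 𝓝[>] 0, 0 < σ * w r := by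
  rcases h.pos_or_neg hlim hne with h1 | h1
  · refine ⟨1, .inl rfl, ?_⟩
    filter_upwards [Ioo_mem_nhdsGT hR] with r hr
    simpa using h1 r hr
  · refine ⟨-1, .inr rfl, h1.mono fun r hr => by linarith⟩

theorem eventually_hasDerivAt_u (h : RadialSystem rho m q theta R u w) (hR : 0 < R) :
    ∀ᶠ r in 𝓝[>] 0, HasDerivAt u (r ^ (2 * rho - 1) * w r) r := by
  filter_upwards [Ioo_mem_nhdsGT hR] with r hr using h.hasDerivAt_u r hr

theorem eventually_hasDerivAt_w (h : RadialSystem rho m q theta R u w) (hR : 0 < R) :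
    ∀ᶠ r in 𝓝[>] 0,
      HasDerivAt w (r ^ (beta rho m q theta - 1) * u r ^ q * |w r| ^ m) r := by
  filter_upwards [Ioo_mem_nhdsGT hR] with r hr using h.hasDerivAt_w r hr

/-- The pure power behaviour of the primitive gives that of `u'`, which is only compatible with
`u(r) → γ` when the exponent `ζ` is positive. -/
theorem powerExpansion (h : RadialSystem rho m q theta R u w) (hR : 0 < R) (hgam : 0 < gam)
    (hlim : Tendsto u (𝓝[>] 0) (𝓝 gam)) (hm1 : m ≠ 1) (hb : beta rho m q theta ≠ 0)
    {σ : ℝ} (hσ : σ = 1 ∨ σ = -1) (hw : ∀ᶠ r in 𝓝[>] 0, 0 < σ * w r)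
    (hφ : (fun r => σ * ((σ * w r) ^ (1 - m) / (1 - m))) ~[𝓝[>] 0]
      fun r => gam ^ q / beta rho m q theta * r ^ beta rho m q theta) :
    0 < zeta m q theta ∧ PowerExpansion rho m q theta gam u := by
  have hG : 0 < gam ^ q := Real.rpow_pos_of_pos hgam q
  have h1 := isEquivalent_of_power_primitive hσ hm1 hb hG hw hφ
  rw [← zeta_sub hm1] at h1
  have hz0 : zeta m q theta - 2 * rho ≠ 0 := by
    rw [zeta_sub hm1]; exact div_ne_zero hb (sub_ne_zero.2 hm1.symm)
  have hK : Real.sign (zeta m q theta - 2 * rho) *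
      (gam ^ q / |zeta m q theta - 2 * rho|) ^ (1 / (1 - m)) ≠ 0 := by
    refine mul_ne_zero (by simpa using hz0) (Real.rpow_pos_of_pos (by positivity) _).ne'
  have h2 : (fun r => r ^ (2 * rho - 1) * w r) ~[𝓝[>] 0] fun r =>
      (Real.sign (zeta m q theta - 2 * rho) *
      (gam ^ q / |zeta m q theta - 2 * rho|) ^ (1 / (1 - m))) * r ^ (zeta m q theta - 1) := by
    refine ((IsEquivalent.refl (u := fun r : ℝ => r ^ (2 * rho - 1))).mul h1).congr_right ?_
    filter_upwards [self_mem_nhdsWithin] with r hr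
    simp only [Pi.mul_apply]
    rw [show zeta m q theta - 1 = (2 * rho - 1) + (zeta m q theta - 2 * rho) by ring,
      Real.rpow_add hr]
    ring
  have hz := exponent_pos_of_deriv_isEquivalent hK (h.eventually_hasDerivAt_u hR) hlim h2
  refine ⟨hz, ?_⟩
  have h3 := isEquivalent_sub_of_deriv hz hK (h.eventually_hasDerivAt_u hR) hlim h2
  unfold PowerExpansion
  convert h3 using 3
  ring

/-- When `w` has a nonzero limit, two integrations give the refined expansion, and the convergence
of `u` forces `ρ > 0`. -/
theorem refinedExpansion (h : RadialSystem rho m q theta R u w) (hR : 0 < R) (hgam : 0 < gam)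
    (hlim : Tendsto u (𝓝[>] 0) (𝓝 gam)) (hb : 0 < beta rho m q theta) {w0 : ℝ} (hw0 : w0 ≠ 0)
    (hw : Tendsto w (𝓝[>] 0) (𝓝 w0)) :
    0 < rho ∧ RefinedExpansion rho m q theta gam (w0 / (2 * rho)) u := by
  have hG : 0 < gam ^ q := Real.rpow_pos_of_pos hgam q
  have hwe : w ~[𝓝[>] 0] fun _ => w0 := (isEquivalent_const_iff_tendsto hw0).2 hw
  have h2 : (fun r => r ^ (2 * rho - 1) * w r) ~[𝓝[>] 0] fun r => w0 * r ^ (2 * rho - 1) := by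
    refine ((IsEquivalent.refl (u := fun r : ℝ => r ^ (2 * rho - 1))).mul hwe).congr_right ?_
    exact .of_forall fun r => mul_comm _ _
  have hrho := exponent_pos_of_deriv_isEquivalent hw0 (h.eventually_hasDerivAt_u hR) hlim h2
  have hrho' : 0 < rho := by linarith
  refine ⟨hrho', ?_⟩
  have hwm : (fun r => |w r| ^ m) ~[𝓝[>] 0] fun _ => |w0| ^ m :=
    (isEquivalent_const_iff_tendsto (Real.rpow_pos_of_pos (abs_pos.2 hw0) _).ne').2
      (hw.abs.rpow_const (.inl (abs_pos.2 hw0).ne'))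
  have hK : gam ^ q * |w0| ^ m ≠ 0 :=
    (mul_pos hG (Real.rpow_pos_of_pos (abs_pos.2 hw0) _)).ne'
  have h3 : (fun r => r ^ (beta rho m q theta - 1) * u r ^ q * |w r| ^ m) ~[𝓝[>] 0]
      fun r => (gam ^ q * |w0| ^ m) * r ^ (beta rho m q theta - 1) := by
    refine ((weight_isEquivalent hgam hlim).mul hwm).congr_right ?_
    exact .of_forall fun r => by simp only [Pi.mul_apply]; ring
  have h4 := isEquivalent_sub_of_deriv hb hK (h.eventually_hasDerivAt_w hR) hw h3
  have h5 : (fun r => r ^ (2 * rho - 1) * (w r - w0)) ~[𝓝[>] 0]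
      fun r => (gam ^ q * |w0| ^ m / beta rho m q theta) *
        r ^ (2 * rho + beta rho m q theta - 1) := by
    refine ((IsEquivalent.refl (u := fun r : ℝ => r ^ (2 * rho - 1))).mul h4).congr_right ?_
    filter_upwards [self_mem_nhdsWithin] with r hr
    simp only [Pi.mul_apply]
    rw [show 2 * rho + beta rho m q theta - 1 = (2 * rho - 1) + beta rho m q theta by ring,
      Real.rpow_add hr]
    ring
  have h6 := isEquivalent_sub_of_deriv (f := fun r => u r - w0 / (2 * rho) * r ^ (2 * rho))
    (l := gam) (by positivity) (div_ne_zero hK hb.ne') ?_ ?_ h5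
  · have e1 : 2 * rho * |w0 / (2 * rho)| = |w0| := by
      rw [abs_div, abs_of_pos hrho]; field_simp
    unfold RefinedExpansion
    rw [e1]
    convert h6 using 2 with r
    · ring
    · rw [div_div]
  · filter_upwards [h.eventually_hasDerivAt_u hR, self_mem_nhdsWithin] with r h1 hr
    refine (h1.sub (hasDerivAt_const_mul_rpow hrho.ne' hr)).congr_deriv ?_
    ring
  · simpa using hlim.sub ((tendsto_rpow_nhdsGT_zero hrho).const_mul (w0 / (2 * rho)))

/-- The dichotomy for `m ≠ 1`: the primitive of the weight `r^(β-1) u^q` either has the pure power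
behaviour `γ^q r^β / β`, or (only for `β > 0`) a nonzero limit. -/
theorem expansion_of_ne_one (h : RadialSystem rho m q theta R u w) (hR : 0 < R) (hgam : 0 < gam)
    (hlim : Tendsto u (𝓝[>] 0) (𝓝 gam)) (hne : ∀ r ∈ Ioo 0 R, ∃ s ∈ Ioo 0 r, u s ≠ gam)
    (hm1 : m ≠ 1) (hb : beta rho m q theta ≠ 0) :
    (0 < zeta m q theta ∧ PowerExpansion rho m q theta gam u) ∨
    (0 < beta rho m q theta ∧ 0 < rho ∧
      ∃ C₁ : ℝ, C₁ ≠ 0 ∧ RefinedExpansion rho m q theta gam C₁ u) := by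
  have h1 : 1 - m ≠ 0 := sub_ne_zero.2 hm1.symm
  obtain ⟨σ, hσ, hw⟩ := h.exists_sign hR hlim hne
  have hG : 0 < gam ^ q := Real.rpow_pos_of_pos hgam q
  have hσ2 : σ * σ = 1 := by rcases hσ with rfl | rfl <;> norm_num
  have hφ' : ∀ᶠ r in 𝓝[>] 0, HasDerivAt (fun x => σ * ((σ * w x) ^ (1 - m) / (1 - m)))
      (r ^ (beta rho m q theta - 1) * u r ^ q) r := by
    filter_upwards [hw, h.eventually_hasDerivAt_w hR] with r h2 h3
    exact hasDerivAt_power_primitive hσ hm1 h2 h3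
  have hwt := weight_isEquivalent (b := beta rho m q theta) (q := q) hgam hlim
  rcases lt_or_gt_of_ne hb with hb' | hb'
  · left
    exact h.powerExpansion hR hgam hlim hm1 hb hσ hw
      (isEquivalent_of_deriv_of_neg hb' hG.ne' hφ' hwt)
  · obtain ⟨c, hc⟩ := exists_tendsto_of_deriv_isBigO_rpow hb' hφ'
      ((isBigO_const_mul_right_iff hG.ne').1 hwt.isBigO)
    by_cases hc0 : c = 0
    · left
      refine h.powerExpansion hR hgam hlim hm1 hb hσ hw ?_
      have := isEquivalent_sub_of_deriv hb' hG.ne' hφ' hc hwt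
      simpa only [hc0, sub_zero] using this
    · right
      have h2 : Tendsto (fun r => (σ * w r) ^ (1 - m)) (𝓝[>] 0) (𝓝 (σ * (1 - m) * c)) := by
        refine (hc.const_mul (σ * (1 - m))).congr fun r => ?_
        field_simp
        linear_combination hσ2 * (σ * w r) ^ (1 - m)
      have hσ0 : σ ≠ 0 := by rintro rfl; simp at hσ2
      have hd : σ * (1 - m) * c ≠ 0 := mul_ne_zero (mul_ne_zero hσ0 h1) hc0
      have hd0 : 0 ≤ σ * (1 - m) * c :=
        ge_of_tendsto h2 (hw.mono fun r hr => Real.rpow_nonneg hr.le _)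
      have h3 : Tendsto w (𝓝[>] 0) (𝓝 (σ * (σ * (1 - m) * c) ^ (1 / (1 - m)))) := by
        refine ((h2.rpow_const (p := 1 / (1 - m)) (.inl hd)).const_mul σ).congr' ?_
        filter_upwards [hw] with r hr
        rw [← Real.rpow_mul hr.le, mul_one_div_cancel h1, Real.rpow_one, ← mul_assoc, hσ2, one_mul]
      have hw0 : σ * (σ * (1 - m) * c) ^ (1 / (1 - m)) ≠ 0 :=
        mul_ne_zero hσ0 (Real.rpow_pos_of_pos (hd0.lt_of_ne hd.symm) _).ne'
      obtain ⟨h4, h5⟩ := h.refinedExpansion hR hgam hlim hb' hw0 h3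
      exact ⟨hb', h4, _, div_ne_zero hw0 (by positivity), h5⟩

theorem refinedExpansion_of_eq_one (h : RadialSystem rho m q theta R u w) (hR : 0 < R)
    (hgam : 0 < gam)
    (hlim : Tendsto u (𝓝[>] 0) (𝓝 gam)) (hne : ∀ r ∈ Ioo 0 R, ∃ s ∈ Ioo 0 r, u s ≠ gam)
    (hm1 : m = 1) (hb : 0 < beta rho m q theta) :
    ∃ C₁ : ℝ, C₁ ≠ 0 ∧ RefinedExpansion rho m q theta gam C₁ u := by
  obtain ⟨σ, hσ, hw⟩ := h.exists_sign hR hlim hne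
  have hG : 0 < gam ^ q := Real.rpow_pos_of_pos hgam q
  have hσ2 : σ * σ = 1 := by rcases hσ with rfl | rfl <;> norm_num
  have hφ' : ∀ᶠ r in 𝓝[>] 0, HasDerivAt (fun x => σ * Real.log (σ * w x))
      (r ^ (beta rho m q theta - 1) * u r ^ q) r := by
    filter_upwards [hw, h.eventually_hasDerivAt_w hR] with r h2 h3
    exact hasDerivAt_log_primitive hσ h2 (by simpa only [hm1] using h3)
  have hwt := weight_isEquivalent (b := beta rho m q theta) (q := q) hgam hlim
  obtain ⟨c, hc⟩ := exists_tendsto_of_deriv_isBigO_rpow hb hφ'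
      ((isBigO_const_mul_right_iff hG.ne').1 hwt.isBigO)
  have hσ0 : σ ≠ 0 := by rintro rfl; simp at hσ2
  have h3 : Tendsto w (𝓝[>] 0) (𝓝 (σ * Real.exp (σ * c))) := by
    refine (((Real.continuous_exp.tendsto _).comp (hc.const_mul σ)).const_mul σ).congr' ?_
    filter_upwards [hw] with r hr
    simp only [Function.comp]
    rw [← mul_assoc, hσ2, one_mul, Real.exp_log hr, ← mul_assoc, hσ2, one_mul]
  have hw0 : σ * Real.exp (σ * c) ≠ 0 := mul_ne_zero hσ0 (Real.exp_pos _).ne'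
  obtain ⟨h4, h5⟩ := h.refinedExpansion hR hgam hlim hb hw0 h3
  exact ⟨_, div_ne_zero hw0 (by positivity), h5⟩

end RadialSystem

/-! ### Exponentially small solutions -/

section ExponentialAsymptotics

theorem tendsto_rpow_mul_exp_neg_rpow {k b c : ℝ} (hb : b < 0) (hc : 0 < c) :
    Tendsto (fun r : ℝ => r ^ k * Real.exp (-c * r ^ b)) (𝓝[>] 0) (𝓝 0) := by
  refine ((tendsto_rpow_mul_exp_neg_mul_atTop_nhds_zero (k / b) c hc).comp
    (tendsto_rpow_neg_nhdsGT_zero hb)).congr' ?_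
  filter_upwards [self_mem_nhdsWithin] with r hr
  rw [Function.comp, ← Real.rpow_mul (le_of_lt hr), mul_div_cancel₀ _ hb.ne]

/-- Integration of an exponentially small asymptotic, by L'Hôpital's rule. -/
theorem isEquivalent_sub_of_deriv_exp {f f' : ℝ → ℝ} {k b G C l : ℝ} (hb : b < 0) (hG : 0 < G)
    (hC : C ≠ 0) (hf : ∀ᶠ r in 𝓝[>] 0, HasDerivAt f (f' r) r) (hl : Tendsto f (𝓝[>] 0) (𝓝 l))
    (hf' : f' ~[𝓝[>] 0] fun r => C * r ^ (k - 1) * Real.exp (G / b * r ^ b)) :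
    (fun r => f r - l) ~[𝓝[>] 0]
      fun r => C / G * r ^ (k - b) * Real.exp (G / b * r ^ b) := by
  have hCG : C / G ≠ 0 := div_ne_zero hC hG.ne'
  have hneg : G / b = -(G / -b) := by rw [div_neg, neg_neg]
  have hGb : 0 < G / -b := div_pos hG (neg_pos.2 hb)
  have hg : ∀ᶠ r in 𝓝[>] (0 : ℝ),
      HasDerivAt (fun r => C / G * r ^ (k - b) * Real.exp (G / b * r ^ b))
        (C * r ^ (k - 1) * Real.exp (G / b * r ^ b) * (1 + (k - b) / G * r ^ (-b))) r := by
    filter_upwards [self_mem_nhdsWithin] with r hr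
    have hr0 : (0 : ℝ) < r := hr
    have h1 := (Real.hasDerivAt_rpow_const (p := k - b) (.inl hr0.ne')).const_mul (C / G)
    have h2 := (hasDerivAt_const_mul_rpow (K := G) hb.ne hr0).exp
    refine (h1.mul h2).congr_deriv ?_
    rw [show k - b - 1 = (k - 1) + -b by ring, show b - 1 = (k - 1) - (k - b) by ring,
      Real.rpow_add hr0, Real.rpow_sub hr0 (k - 1)]
    have := (Real.rpow_pos_of_pos hr0 (k - b)).ne'
    field_simp
    ring
  have hone : Tendsto (fun r : ℝ => 1 + (k - b) / G * r ^ (-b)) (𝓝[>] 0) (𝓝 1) := by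
    simpa using ((tendsto_rpow_nhdsGT_zero (neg_pos.2 hb)).const_mul ((k - b) / G)).const_add 1
  have hge : (fun r : ℝ => C * r ^ (k - 1) * Real.exp (G / b * r ^ b)) ~[𝓝[>] 0]
      fun r => C * r ^ (k - 1) * Real.exp (G / b * r ^ b) * (1 + (k - b) / G * r ^ (-b)) := by
    have := (IsEquivalent.refl (u := fun r : ℝ => C * r ^ (k - 1) * Real.exp (G / b * r ^ b))
      (l := 𝓝[>] 0)).mul ((isEquivalent_const_iff_tendsto one_ne_zero).2 hone)
    refine this.symm.congr_left (.of_forall fun r => ?_)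
    simp
  have hne : ∀ᶠ r in 𝓝[>] (0 : ℝ), 1 + (k - b) / G * r ^ (-b) ≠ 0 :=
    hone.eventually_ne one_ne_zero
  have hg0 : ∀ᶠ r in 𝓝[>] (0 : ℝ),
      C * r ^ (k - 1) * Real.exp (G / b * r ^ b) * (1 + (k - b) / G * r ^ (-b)) ≠ 0 := by
    filter_upwards [hne, self_mem_nhdsWithin] with r h1 hr
    exact mul_ne_zero (mul_ne_zero (mul_ne_zero hC (Real.rpow_pos_of_pos hr _).ne')
      (Real.exp_pos _).ne') h1
  refine isEquivalent_of_tendsto_one ?_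
  refine HasDerivAt.lhopital_zero_nhdsGT (f := fun r => f r - l)
    (hf.mono fun r hr => hr.sub_const l) hg hg0 (by simpa using hl.sub_const l) ?_
    ((isEquivalent_iff_tendsto_one hg0).1 (hf'.trans hge))
  have := (tendsto_rpow_mul_exp_neg_rpow (k := k - b) hb hGb).const_mul (C / G)
  rw [mul_zero] at this
  refine this.congr fun r => ?_
  rw [← hneg, mul_assoc]

end ExponentialAsymptotics

namespace RadialSystem

variable {rho m q theta gam R : ℝ} {u w : ℝ → ℝ}

/-- For `m = 1` and `β < 0` the logarithm of `|w|` behaves like `∓ r ^ β`. On the branch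
`w < 0`, `|w|` is exponentially large at `0`, which is excluded since `u` has a limit. -/
theorem expExpansion (h : RadialSystem rho m q theta R u w) (hR : 0 < R) (hgam : 0 < gam)
    (hk : 0 < kappa m q)
    (hlim : Tendsto u (𝓝[>] 0) (𝓝 gam)) (hne : ∀ r ∈ Ioo 0 R, ∃ s ∈ Ioo 0 r, u s ≠ gam)
    (hm1 : m = 1) (hb : beta rho m q theta < 0) :
    (∀ r ∈ Ioo 0 R, 0 < w r) ∧ ∃ C : ℝ, 0 < C ∧ ExpExpansion rho q theta gam C u := by
  have hbt : beta rho m q theta = theta + 1 := by rw [beta_eq hk, hm1]; ring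
  have hG : 0 < gam ^ q := Real.rpow_pos_of_pos hgam q
  obtain ⟨b, hbdef⟩ : ∃ b, b = beta rho m q theta := ⟨_, rfl⟩
  have hwt := weight_isEquivalent (b := beta rho m q theta) (q := q) hgam hlim
  have hdw := h.eventually_hasDerivAt_w hR
  rw [← hbdef] at hb hwt hbt hdw
  simp only [hm1] at hdw
  have hc : 0 < gam ^ q / -b := div_pos hG (neg_pos.2 hb)
  have hprim : ∀ σ : ℝ, (σ = 1 ∨ σ = -1) → (∀ᶠ r in 𝓝[>] 0, 0 < σ * w r) →
      (∀ᶠ r in 𝓝[>] 0, HasDerivAt (fun x => σ * Real.log (σ * w x)) (r ^ (b - 1) * u r ^ q) r) ∧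
      ∀ᶠ r in 𝓝[>] 0, σ * Real.log (σ * w r) ≤ -(gam ^ q / -b / 2) * r ^ b := by
    intro σ hσ hw
    have hφ' : ∀ᶠ r in 𝓝[>] 0, HasDerivAt (fun x => σ * Real.log (σ * w x))
        (r ^ (b - 1) * u r ^ q) r := by
      filter_upwards [hw, hdw] with r h2 h3
      exact hasDerivAt_log_primitive hσ h2 h3
    refine ⟨hφ', ?_⟩
    have h1 := (isEquivalent_of_deriv_of_neg hb hG.ne' hφ' hwt).isLittleO.def
      (c := 1 / 2) (by norm_num)
    filter_upwards [h1, self_mem_nhdsWithin] with r h2 hr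
    have hpos : 0 < r ^ b := Real.rpow_pos_of_pos hr _
    have e : gam ^ q / b * r ^ b = - (gam ^ q / -b * r ^ b) := by rw [div_neg]; ring
    simp only [Pi.sub_apply, Real.norm_eq_abs] at h2
    rw [e, abs_neg, abs_of_pos (mul_pos hc hpos)] at h2
    linarith [le_of_abs_le h2]
  have hsmall : ∀ k : ℝ, ∀ᶠ r in 𝓝[>] (0 : ℝ),
      r ^ k * Real.exp (-(gam ^ q / -b / 2) * r ^ b) ≤ 1 := fun k =>
    (tendsto_rpow_mul_exp_neg_rpow (k := k) hb (half_pos hc)).eventually_le_const one_pos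
  have hpos : ∀ r ∈ Ioo 0 R, 0 < w r := by
    -- a negative `w` would give `r * (-u') ≥ 1` near `0`
    refine (h.pos_or_neg hlim hne).resolve_right fun hneg => ?_
    obtain ⟨-, hlog⟩ := hprim (-1) (.inr rfl) (hneg.mono fun r hr => by linarith)
    refine not_tendsto_of_le_mul_deriv one_pos
      ((h.eventually_hasDerivAt_u hR).mono fun r hr => hr.neg) ?_ hlim.neg
    filter_upwards [hneg, hlog, hsmall (-(2 * rho)), self_mem_nhdsWithin] with r h1 h2 h3 hr
    have hr0 : (0 : ℝ) < r := hr
    have h4 : Real.exp (-(-(gam ^ q / -b / 2) * r ^ b)) ≤ - w r := by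
      rw [← Real.exp_log (neg_pos.2 h1)]
      refine Real.exp_le_exp.2 ?_
      rw [neg_one_mul, neg_one_mul] at h2
      linarith
    rw [Real.exp_neg] at h4
    rw [Real.rpow_neg hr0.le, ← div_eq_inv_mul, div_le_one (Real.rpow_pos_of_pos hr0 _)] at h3
    have h5 : r * r ^ (2 * rho - 1) = r ^ (2 * rho) := by
      rw [Real.rpow_sub hr0, Real.rpow_one, mul_div_cancel₀ _ hr0.ne']
    have hE := Real.exp_pos (-(gam ^ q / -b / 2) * r ^ b)
    calc (1 : ℝ) = Real.exp (-(gam ^ q / -b / 2) * r ^ b) *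
          (Real.exp (-(gam ^ q / -b / 2) * r ^ b))⁻¹ := (mul_inv_cancel₀ hE.ne').symm
      _ ≤ r ^ (2 * rho) * (- w r) := by gcongr
      _ = _ := by rw [← h5]; ring
  refine ⟨hpos, ?_⟩
  have hwpos : ∀ᶠ r in 𝓝[>] 0, 0 < w r := by
    filter_upwards [Ioo_mem_nhdsGT hR] with r hr using hpos r hr
  obtain ⟨hφ', hlog⟩ := hprim 1 (.inl rfl) (hwpos.mono fun r hr => by linarith)
  simp only [one_mul] at hφ' hlog
  -- `u - γ` is small enough to make `r ^ (β - 1) * (u ^ q - γ ^ q)` bounded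
  have hu : (fun r => u r - gam) =O[𝓝[>] 0] fun r => r ^ (1 - b) := by
    refine isBigO_sub_of_deriv (by linarith) (h.eventually_hasDerivAt_u hR) hlim ?_
    refine IsBigO.of_bound 1 ?_
    filter_upwards [hwpos, hlog, hsmall (2 * rho - 1 - (1 - b - 1)), self_mem_nhdsWithin]
      with r h1 h2 h3 hr
    have hr0 : (0 : ℝ) < r := hr
    have hA := Real.rpow_pos_of_pos hr0 (2 * rho - 1)
    have hB := Real.rpow_pos_of_pos hr0 (1 - b - 1)
    rw [Real.norm_eq_abs, Real.norm_eq_abs, abs_of_pos (mul_pos hA h1), abs_of_pos hB, one_mul]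
    rw [Real.rpow_sub hr0 (2 * rho - 1), div_mul_eq_mul_div, div_le_one hB] at h3
    refine le_trans ?_ h3
    gcongr
    rw [← Real.exp_log h1]
    exact Real.exp_le_exp.2 h2
  have huq : (fun r => u r ^ q - gam ^ q) =O[𝓝[>] 0] fun r => r ^ (1 - b) := by
    have hd := (Real.hasDerivAt_rpow_const (x := gam) (p := q) (.inl hgam.ne')).isBigO_sub
    exact (hd.comp_tendsto hlim).trans hu
  have hdiff : ∀ᶠ r in 𝓝[>] 0, HasDerivAt (fun x => Real.log (w x) - gam ^ q / b * x ^ b)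
      (r ^ (b - 1) * (u r ^ q - gam ^ q)) r := by
    filter_upwards [hφ', self_mem_nhdsWithin] with r h1 hr
    refine (h1.sub (hasDerivAt_const_mul_rpow hb.ne hr)).congr_deriv ?_
    ring
  obtain ⟨c, hcl⟩ := exists_tendsto_of_deriv_isBigO_rpow one_pos hdiff (by
    refine ((isBigO_refl (fun r : ℝ => r ^ (b - 1)) (𝓝[>] 0)).mul huq).congr' .rfl ?_
    filter_upwards [self_mem_nhdsWithin] with r hr
    rw [← Real.rpow_add hr]
    congr 1
    ring)
  have hw : w ~[𝓝[>] 0] fun r => Real.exp c * Real.exp (gam ^ q / b * r ^ b) := by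
    refine isEquivalent_of_tendsto_one ?_
    have := (Real.continuous_exp.tendsto 0).comp (show Tendsto
      (fun r => (Real.log (w r) - gam ^ q / b * r ^ b) - c) (𝓝[>] 0) (𝓝 0) by
        simpa using hcl.sub_const c)
    rw [Real.exp_zero] at this
    refine this.congr' ?_
    filter_upwards [hwpos] with r hr
    simp only [Function.comp, Pi.div_apply]
    rw [Real.exp_sub, Real.exp_sub, Real.exp_log hr, div_div, mul_comm (Real.exp c)]
  have hu' : (fun r => r ^ (2 * rho - 1) * w r) ~[𝓝[>] 0]
      fun r => Real.exp c * r ^ (2 * rho - 1) * Real.exp (gam ^ q / b * r ^ b) := by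
    refine ((IsEquivalent.refl (u := fun r : ℝ => r ^ (2 * rho - 1))).mul hw).congr_right ?_
    exact .of_forall fun r => by simp only [Pi.mul_apply]; ring
  have hfin := isEquivalent_sub_of_deriv_exp hb hG (Real.exp_pos c).ne'
    (h.eventually_hasDerivAt_u hR) hlim hu'
  refine ⟨Real.exp c / gam ^ q, div_pos (Real.exp_pos _) hG, ?_⟩
  unfold ExpExpansion
  rw [← hbt, show 2 * rho - 1 - theta = 2 * rho - b by rw [hbt]; ring]
  exact hfin

end RadialSystem

/-! ### The integral equation and the potential -/

section FixedPoint

open MeasureTheory in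
/-- Contraction principle for the integral equation `u(r) = γ + ∫₀^r K(u)(s) ds` on functions with
`|u - γ| ≤ η`, where `K(u)` is dominated by, and Lipschitz in `u` with constant, an integrable
function `g` that may be unbounded at `0`. -/
theorem exists_integral_fixedPoint {gam η R : ℝ} (hη : 0 ≤ η) {K : (ℝ → ℝ) → ℝ → ℝ} {g : ℝ → ℝ}
    (hg : IntegrableOn g (Ioo 0 R)) (hgη : ∫ s in Ioo 0 R, g s ≤ η)
    (hg2 : ∫ s in Ioo 0 R, g s ≤ 1 / 2)
    (hcont : ∀ u, Continuous u → (∀ x, |u x - gam| ≤ η) → ContinuousOn (K u) (Ioo 0 R))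
    (hbound : ∀ u, Continuous u → (∀ x, |u x - gam| ≤ η) → ∀ s ∈ Ioo 0 R, |K u s| ≤ g s)
    (hlip : ∀ u v, Continuous u → Continuous v → (∀ x, |u x - gam| ≤ η) →
      (∀ x, |v x - gam| ≤ η) → ∀ d, (∀ x, |u x - v x| ≤ d) →
      ∀ s ∈ Ioo 0 R, |K u s - K v s| ≤ d * g s) :
    ∃ u : ℝ → ℝ, Continuous u ∧ (∀ x, |u x - gam| ≤ η) ∧ Tendsto u (𝓝[>] 0) (𝓝 gam) ∧
      ∀ r ∈ Ioo 0 R, HasDerivAt u (K u r) r := by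
  have hG : Integrable ((Ioo 0 R).indicator g) := (integrable_indicator_iff measurableSet_Ioo).2 hg
  have hGi : ∫ s, (Ioo 0 R).indicator g s = ∫ s in Ioo 0 R, g s :=
    integral_indicator measurableSet_Ioo
  have hg0 : ∀ s ∈ Ioo 0 R, 0 ≤ g s := fun s hs =>
    (abs_nonneg _).trans (hbound (fun _ => gam) continuous_const (by simpa using hη) s hs)
  have hG0 : ∀ s, 0 ≤ (Ioo 0 R).indicator g s := indicator_nonneg hg0
  have hest : ∀ (f : ℝ → ℝ) (c r : ℝ), 0 ≤ c → (∀ s ∈ Ioo 0 R, |f s| ≤ c * g s) →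
      |∫ s in (0 : ℝ)..r, (Ioo 0 R).indicator f s| ≤ c * ∫ s in Ioo 0 R, g s := by
    intro f c r hc hf
    have h1 : ∀ s, ‖(Ioo 0 R).indicator f s‖ ≤ c * (Ioo 0 R).indicator g s := by
      intro s
      by_cases hs : s ∈ Ioo 0 R
      · simpa [hs] using hf s hs
      · simp [hs]
    calc |∫ s in (0 : ℝ)..r, (Ioo 0 R).indicator f s|
        = ‖∫ s in uIoc 0 r, (Ioo 0 R).indicator f s‖ :=
          intervalIntegral.norm_integral_eq_norm_integral_uIoc (f := (Ioo 0 R).indicator f)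
      _ ≤ ∫ s in uIoc 0 r, c * (Ioo 0 R).indicator g s :=
          norm_integral_le_of_norm_le (hG.const_mul c).integrableOn (.of_forall h1)
      _ ≤ ∫ s, c * (Ioo 0 R).indicator g s :=
          setIntegral_le_integral (hG.const_mul c) (.of_forall fun s => mul_nonneg hc (hG0 s))
      _ = _ := by rw [integral_const_mul, hGi]
  have hKint : ∀ u, Continuous u → (∀ x, |u x - gam| ≤ η) →
      Integrable ((Ioo 0 R).indicator (K u)) := by
    intro u hu hub
    refine (integrable_indicator_iff measurableSet_Ioo).2 (hg.mono'
      ((hcont u hu hub).aestronglyMeasurable measurableSet_Ioo) ?_)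
    exact (ae_restrict_iff' measurableSet_Ioo).2 (.of_forall fun s hs => hbound u hu hub s hs)
  let S : Set (BoundedContinuousFunction ℝ ℝ) := {u | ∀ x, |u x - gam| ≤ η}
  have hSclosed : IsClosed S := by
    simp only [S, ofPred_forall]
    refine isClosed_iInter fun x => isClosed_le ?_ continuous_const
    have : Continuous fun u : BoundedContinuousFunction ℝ ℝ => u x :=
      continuous_eval_const x
    fun_prop
  have : CompleteSpace S := hSclosed.completeSpace_coe
  have : Nonempty S := ⟨⟨BoundedContinuousFunction.const ℝ gam, fun x => by simpa using hη⟩⟩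
  have hTb : ∀ u : S, ∀ r,
      |(gam + ∫ s in (0 : ℝ)..r, (Ioo 0 R).indicator (K u.1) s) - gam| ≤ η := by
    intro u r
    rw [add_sub_cancel_left]
    refine (hest (K u.1) 1 r zero_le_one fun s hs => ?_).trans (by rwa [one_mul])
    rw [one_mul]
    exact hbound _ u.1.continuous u.2 s hs
  let T : S → S := fun u => ⟨BoundedContinuousFunction.ofNormedAddCommGroup
    (fun r => gam + ∫ s in (0 : ℝ)..r, (Ioo 0 R).indicator (K u.1) s)
    (continuous_const.add (intervalIntegral.continuous_primitive
      (fun a b => (hKint _ u.1.continuous u.2).intervalIntegrable) 0)) (|gam| + η)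
    (fun r => by
      have h1 := hTb u r
      have h2 := abs_sub_abs_le_abs_sub
        (gam + ∫ s in (0 : ℝ)..r, (Ioo 0 R).indicator (K u.1) s) gam
      rw [Real.norm_eq_abs]
      linarith), hTb u⟩
  have hT : ContractingWith (1 / 2) T := by
    refine ⟨by rw [← NNReal.coe_lt_coe]; norm_num, LipschitzWith.of_dist_le_mul fun u v => ?_⟩
    rw [Subtype.dist_eq, BoundedContinuousFunction.dist_le (by positivity)]
    intro r
    have hd : ∀ x, |u.1 x - v.1 x| ≤ dist u v := fun x =>
      BoundedContinuousFunction.dist_coe_le_dist (f := u.1) (g := v.1) x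
    have h1 := hest (fun s => K u.1 s - K v.1 s) (dist u v) r dist_nonneg
      (hlip _ _ u.1.continuous v.1.continuous u.2 v.2 _ hd)
    have h2 : dist ((T u).1 r) ((T v).1 r) =
        |∫ s in (0 : ℝ)..r, (Ioo 0 R).indicator (fun s => K u.1 s - K v.1 s) s| := by
      change |(gam + ∫ s in (0 : ℝ)..r, (Ioo 0 R).indicator (K u.1) s) -
        (gam + ∫ s in (0 : ℝ)..r, (Ioo 0 R).indicator (K v.1) s)| = _
      rw [add_sub_add_left_eq_sub, ← intervalIntegral.integral_sub
        (hKint _ u.1.continuous u.2).intervalIntegrable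
        (hKint _ v.1.continuous v.2).intervalIntegrable]
      congr 1
      refine intervalIntegral.integral_congr fun s _ => ?_
      by_cases hs : s ∈ Ioo 0 R <;> simp [hs]
    rw [h2]
    have h3 : (((1 / 2 : NNReal)) : ℝ) = 1 / 2 := by norm_num
    rw [h3]
    have h4 : (0 : ℝ) ≤ dist u v := dist_nonneg
    nlinarith
  obtain ⟨u, hu⟩ : ∃ u, T u = u := ⟨_, hT.fixedPoint_isFixedPt⟩
  have hur : ∀ r, u.1 r = gam + ∫ s in (0 : ℝ)..r, (Ioo 0 R).indicator (K u.1) s := fun r => by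
    conv_lhs => rw [← hu]
    rfl
  refine ⟨u.1, u.1.continuous, u.2, ?_, fun r hr => ?_⟩
  · have h0 := hur 0
    rw [intervalIntegral.integral_same, add_zero] at h0
    rw [← h0]
    exact (u.1.continuous.tendsto 0).mono_left nhdsWithin_le_nhds
  · have hnhds := isOpen_Ioo.mem_nhds hr
    have hKc : ContinuousAt ((Ioo 0 R).indicator (K u.1)) r :=
      ((hcont _ u.1.continuous u.2).continuousAt hnhds).congr (by
        filter_upwards [hnhds] with s hs
        rw [indicator_of_mem hs])
    have := (intervalIntegral.integral_hasDerivAt_right (a := 0)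
      (hKint _ u.1.continuous u.2).intervalIntegrable
      (hKint _ u.1.continuous u.2).aestronglyMeasurable.stronglyMeasurableAtFilter
      hKc).const_add gam
    rw [indicator_of_mem hr] at this
    exact this.congr_of_eventuallyEq (.of_forall hur)

end FixedPoint

section Potential

variable {b q R a : ℝ} {u v : ℝ → ℝ}

/-- The primitive of the weight `r ^ (b - 1) * u r ^ q` obtained by the substitution `τ = r ^ b`,
which for `b > 0` integrates from `0` and for `b < 0` from `∞`, where `u ^ q` is replaced by the
constant `a` beyond `R`. -/
def potential (b q R a : ℝ) (u : ℝ → ℝ) (s : ℝ) : ℝ :=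
  b⁻¹ * ∫ τ in (0 : ℝ)..s ^ b, if τ ^ (1 / b) < R then u (τ ^ (1 / b)) ^ q else a

theorem measurable_potential_integrand (hu : Continuous u) :
    Measurable fun τ : ℝ => if τ ^ (1 / b) < R then u (τ ^ (1 / b)) ^ q else a := by
  have hmeas : Measurable fun τ : ℝ => τ ^ (1 / b) := by fun_prop
  exact Measurable.ite (measurableSet_lt hmeas measurable_const)
    ((hu.measurable.comp hmeas).pow_const q) measurable_const

theorem intervalIntegrable_potential (hu : Continuous u) {B₁ B₂ : ℝ} (ha : a ∈ Icc B₁ B₂)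
    (hB : ∀ x, u x ^ q ∈ Icc B₁ B₂) (x y : ℝ) :
    IntervalIntegrable (fun τ => if τ ^ (1 / b) < R then u (τ ^ (1 / b)) ^ q else a)
      MeasureTheory.volume x y := by
  refine (intervalIntegrable_const (c := max |B₁| |B₂|)).mono_fun
    (measurable_potential_integrand hu).aestronglyMeasurable
    (.of_forall fun τ => ?_)
  simp only [Real.norm_eq_abs]
  rw [abs_of_nonneg (le_max_of_le_left (abs_nonneg B₁) : 0 ≤ max |B₁| |B₂|)]
  split_ifs
  · exact abs_le_max_abs_abs (hB _).1 (hB _).2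
  · exact abs_le_max_abs_abs ha.1 ha.2

theorem potential_mem (hb : b ≠ 0) (hu : Continuous u) {B₁ B₂ : ℝ} (ha : a ∈ Icc B₁ B₂)
    (hB : ∀ x, u x ^ q ∈ Icc B₁ B₂) {s : ℝ} (hs : 0 < s) :
    b * potential b q R a u s ∈ Icc (B₁ * s ^ b) (B₂ * s ^ b) := by
  have hsb : 0 ≤ s ^ b := (Real.rpow_pos_of_pos hs b).le
  have hint := intervalIntegrable_potential (b := b) (R := R) hu ha hB 0 (s ^ b)
  have hV : ∀ τ : ℝ, (if τ ^ (1 / b) < R then u (τ ^ (1 / b)) ^ q else a) ∈ Icc B₁ B₂ := by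
    intro τ
    split_ifs
    · exact hB _
    · exact ha
  rw [potential, mul_inv_cancel_left₀ hb]
  constructor
  · have := intervalIntegral.integral_mono_on hsb intervalIntegrable_const hint
      (fun τ _ => (hV τ).1)
    simpa [mul_comm] using this
  · have := intervalIntegral.integral_mono_on hsb hint intervalIntegrable_const
      (fun τ _ => (hV τ).2)
    simpa [mul_comm] using this

theorem abs_potential_sub_le (hu : Continuous u) (hv : Continuous v) {B₁ B₂ : ℝ}
    (ha : a ∈ Icc B₁ B₂) (huB : ∀ x, u x ^ q ∈ Icc B₁ B₂) (hvB : ∀ x, v x ^ q ∈ Icc B₁ B₂)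
    {c : ℝ} (hc : ∀ x, |u x ^ q - v x ^ q| ≤ c) {s : ℝ} (hs : 0 < s) :
    |potential b q R a u s - potential b q R a v s| ≤ |b|⁻¹ * (c * s ^ b) := by
  have hsb : 0 ≤ s ^ b := (Real.rpow_pos_of_pos hs b).le
  have hc0 : 0 ≤ c := (abs_nonneg _).trans (hc 0)
  rw [potential, potential, ← mul_sub, abs_mul, abs_inv, ← intervalIntegral.integral_sub
    (intervalIntegrable_potential hu ha huB _ _) (intervalIntegrable_potential hv ha hvB _ _)]
  refine mul_le_mul_of_nonneg_left ?_ (by positivity)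
  have h1 : ∀ τ : ℝ, ‖(if τ ^ (1 / b) < R then u (τ ^ (1 / b)) ^ q else a) -
      (if τ ^ (1 / b) < R then v (τ ^ (1 / b)) ^ q else a)‖ ≤ c := by
    intro τ
    rw [Real.norm_eq_abs]
    split_ifs
    · exact hc _
    · simpa using hc0
  exact (intervalIntegral.norm_integral_le_of_norm_le_const fun τ _ => h1 τ).trans_eq
    (by rw [sub_zero, abs_of_nonneg hsb])

theorem hasDerivAt_potential (hb : b ≠ 0) (hu : Continuous u) {B₁ B₂ : ℝ}
    (ha : a ∈ Icc B₁ B₂) (huB : ∀ x, u x ^ q ∈ Icc B₁ B₂) (hpos : ∀ x, 0 < u x)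
    {s : ℝ} (hs : s ∈ Ioo 0 R) :
    HasDerivAt (potential b q R a u) (s ^ (b - 1) * u s ^ q) s := by
  have hsb : 0 < s ^ b := Real.rpow_pos_of_pos hs.1 b
  have hsinv : (s ^ b) ^ (1 / b) = s := by
    rw [← Real.rpow_mul hs.1.le, mul_one_div_cancel hb, Real.rpow_one]
  have hcpow : ContinuousAt (fun τ : ℝ => τ ^ (1 / b)) (s ^ b) :=
    Real.continuousAt_rpow_const _ _ (.inl hsb.ne')
  have hV : ContinuousAt (fun τ : ℝ => if τ ^ (1 / b) < R then u (τ ^ (1 / b)) ^ q else a)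
      (s ^ b) := by
    have h1 : ContinuousAt (fun τ : ℝ => u (τ ^ (1 / b)) ^ q) (s ^ b) :=
      (ContinuousAt.comp hu.continuousAt hcpow).rpow_const (.inl (hpos _).ne')
    refine h1.congr ?_
    have : ∀ᶠ τ : ℝ in 𝓝 (s ^ b), τ ^ (1 / b) < R :=
      hcpow.eventually_lt_const (by simpa only [hsinv] using hs.2)
    filter_upwards [this] with τ hτ
    rw [if_pos hτ]
  have hint := intervalIntegrable_potential (b := b) (R := R) hu ha huB
  have h2 := intervalIntegral.integral_hasDerivAt_right (hint 0 (s ^ b))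
    (measurable_potential_integrand hu).aestronglyMeasurable.stronglyMeasurableAtFilter hV
  have h3 := (h2.comp s (Real.hasDerivAt_rpow_const (p := b) (.inl hs.1.ne'))).const_mul b⁻¹
  refine h3.congr_deriv ?_
  rw [hsinv, if_pos hs.2]
  field_simp

/-- For `b < 0`, two potentials built from functions agreeing on `(0, R)` differ only by the
contribution of the constants beyond `R`. -/
theorem potential_sub_of_neg (hb : b < 0) (hu : Continuous u) (hv : Continuous v)
    {B₁ B₂ a' : ℝ} (ha : a ∈ Icc B₁ B₂) (ha' : a' ∈ Icc B₁ B₂) (huB : ∀ x, u x ^ q ∈ Icc B₁ B₂)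
    (hvB : ∀ x, v x ^ q ∈ Icc B₁ B₂) (huv : EqOn u v (Ioo 0 R)) {s : ℝ} (hs : s ∈ Ioo 0 R) :
    b * (potential b q R a u s - potential b q R a' v s) = (a - a') * R ^ b := by
  have hR : 0 < R := hs.1.trans hs.2
  have hRb : 0 < R ^ b := Real.rpow_pos_of_pos hR b
  have hle : R ^ b ≤ s ^ b := Real.rpow_le_rpow_of_nonpos hs.1 hs.2.le hb.le
  have hb' : 1 / b < 0 := one_div_neg.2 hb
  have hRinv : (R ^ b) ^ (1 / b) = R := by
    rw [← Real.rpow_mul hR.le, mul_one_div_cancel hb.ne, Real.rpow_one]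
  have hint := intervalIntegrable_potential (b := b) (R := R) hu ha huB
  have hint' := intervalIntegrable_potential (b := b) (R := R) hv ha' hvB
  have hinner : ∀ (c : ℝ) (f : ℝ → ℝ), ∫ τ in (0 : ℝ)..R ^ b,
      (if τ ^ (1 / b) < R then f (τ ^ (1 / b)) ^ q else c) = c * R ^ b := by
    intro c f
    rw [intervalIntegral.integral_congr_Ioo_of_le (g := fun _ => c) hRb.le fun τ hτ => ?_]
    · simp [mul_comm]
    · have := Real.rpow_le_rpow_of_nonpos hτ.1 hτ.2.le hb'.le
      rw [hRinv] at this
      exact if_neg (not_lt.2 this)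
  have houter : ∫ τ in R ^ b..s ^ b, (if τ ^ (1 / b) < R then u (τ ^ (1 / b)) ^ q else a) =
      ∫ τ in R ^ b..s ^ b, (if τ ^ (1 / b) < R then v (τ ^ (1 / b)) ^ q else a') := by
    refine intervalIntegral.integral_congr_Ioo_of_le hle fun τ hτ => ?_
    have hτ0 : 0 < τ := hRb.trans hτ.1
    have := Real.rpow_lt_rpow_of_neg hRb hτ.1 hb'
    rw [hRinv] at this
    simp only [if_pos this]
    rw [huv ⟨Real.rpow_pos_of_pos hτ0 _, this⟩]
  rw [potential, potential, ← mul_sub, mul_inv_cancel_left₀ hb.ne,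
    ← intervalIntegral.integral_add_adjacent_intervals (hint 0 (R ^ b)) (hint _ _),
    ← intervalIntegral.integral_add_adjacent_intervals (hint' 0 (R ^ b)) (hint' _ _),
    hinner, hinner, houter]
  ring

end Potential

/-! ### Construction of solutions -/

section Existence

variable {rho m q theta gam : ℝ}

theorem RadialSystem.mem_solutionSet {N : ℕ} {R : ℝ} {u w : ℝ → ℝ} (hm : 0 < m)
    (hk : 0 < kappa m q) (h : RadialSystem rho m q theta R u w) (hw : ∀ r ∈ Ioo 0 R, w r ≠ 0)
    (hlim : Tendsto u (𝓝[>] 0) (𝓝 gam)) : u ∈ solutionSet N rho 0 theta m q gam R := by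
  refine ⟨h.isPositiveRadialSolution hm hk, hlim, rStar_eq_zero_iff.2 fun r hr => ?_⟩
  by_contra! hc
  have hr2 : r / 2 ∈ Ioo 0 r := ⟨half_pos hr.1, half_lt_self hr.1⟩
  have hr2' : r / 2 ∈ Ioo 0 R := ⟨hr2.1, hr2.2.trans hr.2⟩
  have h0 : HasDerivAt u 0 (r / 2) := (hasDerivAt_const (r / 2) gam).congr_of_eventuallyEq (by
    filter_upwards [isOpen_Ioo.mem_nhds hr2] with s hs using hc s hs)
  exact mul_ne_zero (Real.rpow_pos_of_pos hr2.1 _).ne' (hw _ hr2')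
    ((h.hasDerivAt_u _ hr2').unique h0)

theorem exists_abs_rpow_sub_le (hgam : 0 < gam) (q : ℝ) :
    ∃ Λ : ℝ, 0 ≤ Λ ∧ ∀ x ∈ Icc (gam / 2) (3 * gam / 2), ∀ y ∈ Icc (gam / 2) (3 * gam / 2),
      |x ^ q - y ^ q| ≤ Λ * |x - y| := by
  have hpos : ∀ x ∈ Icc (gam / 2) (3 * gam / 2), x ≠ 0 := fun x hx => by
    have := hx.1; intro h; linarith
  obtain ⟨Λ, hΛ⟩ := isCompact_Icc.exists_bound_of_continuousOn
    (s := Icc (gam / 2) (3 * gam / 2)) (f := fun x => q * x ^ (q - 1)) (fun x hx =>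
      (continuousAt_const.mul
        (Real.continuousAt_rpow_const _ _ (.inl (hpos x hx)))).continuousWithinAt)
  refine ⟨Λ, (norm_nonneg _).trans (hΛ gam ⟨by linarith, by linarith⟩), fun x hx y hy => ?_⟩
  exact (convex_Icc _ _).norm_image_sub_le_of_norm_hasDerivWithin_le
    (fun z hz => (Real.hasDerivAt_rpow_const (.inl (hpos z hz))).hasDerivWithinAt) hΛ hy hx

theorem setIntegral_Ioo_rpow {p R : ℝ} (hp : 0 < p) (hR : 0 ≤ R) :
    ∫ s in Ioo 0 R, s ^ (p - 1) = R ^ p / p := by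
  rw [← MeasureTheory.integral_Ioc_eq_integral_Ioo, ← intervalIntegral.integral_of_le hR,
    integral_rpow (.inl (by linarith)), sub_add_cancel, Real.zero_rpow hp.ne', sub_zero]

theorem integrableOn_Ioo_rpow {p R : ℝ} (hp : 0 < p) (hR : 0 ≤ R) :
    MeasureTheory.IntegrableOn (fun s : ℝ => s ^ (p - 1)) (Ioo 0 R) :=
  (intervalIntegrable_iff_integrableOn_Ioo_of_le hR).1
    (intervalIntegral.intervalIntegrable_rpow' (by linarith))

/-- Construction of solutions. If `Φ' = |Φ|^m`, then `w = Φ ∘ φ` solves `w' = φ' |w|^m`, so the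
system reduces to the fixed point problem `u' = r^(2ρ-1) Φ(φ)` with `φ` the potential of `u`. The
exponent `e` measures the growth of `w` at `0`; the two positivity conditions make the right-hand
side and its Lipschitz constant in `u` integrable. -/
theorem exists_radialSystem_of_flow (hgam : 0 < gam) (hm : 0 < m) (hb : beta rho m q theta ≠ 0)
    {B₁ B₂ : ℝ} (hB : ∀ x ∈ Icc (gam / 2) (3 * gam / 2), x ^ q ∈ Icc B₁ B₂) {Φ : ℝ → ℝ}
    {C e R₀ : ℝ} (hR₀ : 0 < R₀) (hC : 0 ≤ C) (he1 : 0 < 2 * rho + e)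
    (he2 : 0 < 2 * rho + e * m + beta rho m q theta)
    (hΦ : ∀ s ∈ Ioo 0 R₀, ∀ x, beta rho m q theta * x ∈
        Icc (B₁ * s ^ beta rho m q theta) (B₂ * s ^ beta rho m q theta) →
      HasDerivAt Φ (|Φ x| ^ m) x ∧ |Φ x| ≤ C * s ^ e) :
    ∃ R, 0 < R ∧ R ≤ R₀ ∧ ∀ a ∈ Icc B₁ B₂, ∃ u : ℝ → ℝ, Continuous u ∧
      (∀ x, u x ^ q ∈ Icc B₁ B₂) ∧ Tendsto u (𝓝[>] 0) (𝓝 gam) ∧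
      RadialSystem rho m q theta R u
        (fun s => Φ (potential (beta rho m q theta) q R a u s)) := by
  set b := beta rho m q theta with hbdef
  obtain ⟨Λ, hΛ0, hΛ⟩ := exists_abs_rpow_sub_le hgam q
  set c₂ := |b|⁻¹ * Λ * C ^ m with hc₂
  have hc₂0 : 0 ≤ c₂ := by positivity
  have hsmall : Tendsto (fun R : ℝ => C * (R ^ (2 * rho + e) / (2 * rho + e)) +
      c₂ * (R ^ (2 * rho + e * m + b) / (2 * rho + e * m + b))) (𝓝[>] 0) (𝓝 0) := by
    have h1 := ((tendsto_rpow_nhdsGT_zero he1).div_const (2 * rho + e)).const_mul C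
    have h2 := ((tendsto_rpow_nhdsGT_zero he2).div_const (2 * rho + e * m + b)).const_mul c₂
    simpa using h1.add h2
  obtain ⟨R, ⟨hRη, hR2⟩, hR⟩ := (((hsmall.eventually_le_const (half_pos hgam)).and
    (hsmall.eventually_le_const one_half_pos)).and (show ∀ᶠ r in 𝓝[>] 0, r ∈ Ioo 0 R₀ from
      Ioo_mem_nhdsGT hR₀)).exists
  have hsub : ∀ s ∈ Ioo 0 R, s ∈ Ioo 0 R₀ := fun s hs => ⟨hs.1, hs.2.trans hR.2⟩
  refine ⟨R, hR.1, hR.2.le, fun a ha => ?_⟩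
  have hI : ∫ s in Ioo 0 R, (C * s ^ (2 * rho + e - 1) + c₂ * s ^ (2 * rho + e * m + b - 1)) =
      C * (R ^ (2 * rho + e) / (2 * rho + e)) +
      c₂ * (R ^ (2 * rho + e * m + b) / (2 * rho + e * m + b)) := by
    rw [MeasureTheory.integral_add ((integrableOn_Ioo_rpow he1 hR.1.le).const_mul C)
      ((integrableOn_Ioo_rpow he2 hR.1.le).const_mul c₂), MeasureTheory.integral_const_mul,
      MeasureTheory.integral_const_mul, setIntegral_Ioo_rpow he1 hR.1.le,
      setIntegral_Ioo_rpow he2 hR.1.le]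
  have hrange : ∀ u : ℝ → ℝ, (∀ x, |u x - gam| ≤ gam / 2) →
      ∀ x, u x ∈ Icc (gam / 2) (3 * gam / 2) := by
    intro u hu x
    have := abs_le.1 (hu x)
    constructor <;> linarith
  have hpos : ∀ u : ℝ → ℝ, (∀ x, |u x - gam| ≤ gam / 2) → ∀ x, 0 < u x := fun u hu x =>
    (half_pos hgam).trans_le (hrange u hu x).1
  have hmem : ∀ u : ℝ → ℝ, Continuous u → (∀ x, |u x - gam| ≤ gam / 2) → ∀ s ∈ Ioo 0 R,
      b * potential b q R a u s ∈ Icc (B₁ * s ^ b) (B₂ * s ^ b) := fun u hu hub s hs =>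
    potential_mem hb hu ha (fun x => hB _ (hrange u hub x)) hs.1
  have hdw : ∀ u : ℝ → ℝ, Continuous u → (∀ x, |u x - gam| ≤ gam / 2) → ∀ s ∈ Ioo 0 R,
      HasDerivAt (fun s => Φ (potential b q R a u s))
        (s ^ (b - 1) * u s ^ q * |Φ (potential b q R a u s)| ^ m) s := by
    intro u hu hub s hs
    have h1 := (hΦ s (hsub s hs) _ (hmem u hu hub s hs)).1.comp s
      (hasDerivAt_potential hb hu ha (fun x => hB _ (hrange u hub x)) (hpos u hub) hs)
    exact h1.congr_deriv (mul_comm _ _)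
  have hbound : ∀ u : ℝ → ℝ, Continuous u → (∀ x, |u x - gam| ≤ gam / 2) → ∀ s ∈ Ioo 0 R,
      |s ^ (2 * rho - 1) * Φ (potential b q R a u s)| ≤
        C * s ^ (2 * rho + e - 1) + c₂ * s ^ (2 * rho + e * m + b - 1) := by
    intro u hu hub s hs
    have h1 := (hΦ s (hsub s hs) _ (hmem u hu hub s hs)).2
    have h2 : 0 ≤ c₂ * s ^ (2 * rho + e * m + b - 1) :=
      mul_nonneg hc₂0 (Real.rpow_nonneg hs.1.le _)
    have h3 : 0 < s ^ (2 * rho - 1) := Real.rpow_pos_of_pos hs.1 _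
    rw [abs_mul, abs_of_pos h3]
    calc s ^ (2 * rho - 1) * |Φ (potential b q R a u s)|
        ≤ s ^ (2 * rho - 1) * (C * s ^ e) := by gcongr
      _ = C * s ^ (2 * rho + e - 1) := by
        rw [show 2 * rho + e - 1 = (2 * rho - 1) + e by ring, Real.rpow_add hs.1]; ring
      _ ≤ _ := le_add_of_nonneg_right h2
  have hlip : ∀ u v : ℝ → ℝ, Continuous u → Continuous v → (∀ x, |u x - gam| ≤ gam / 2) →
      (∀ x, |v x - gam| ≤ gam / 2) → ∀ d, (∀ x, |u x - v x| ≤ d) → ∀ s ∈ Ioo 0 R,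
      |s ^ (2 * rho - 1) * Φ (potential b q R a u s) -
        s ^ (2 * rho - 1) * Φ (potential b q R a v s)| ≤
        d * (C * s ^ (2 * rho + e - 1) + c₂ * s ^ (2 * rho + e * m + b - 1)) := by
    intro u v hu hv hub hvb d hd s hs
    have hd0 : 0 ≤ d := (abs_nonneg _).trans (hd 0)
    have h3 : 0 < s ^ (2 * rho - 1) := Real.rpow_pos_of_pos hs.1 _
    have hconv : Convex ℝ {x | b * x ∈ Icc (B₁ * s ^ b) (B₂ * s ^ b)} :=
      (convex_Icc (B₁ * s ^ b) (B₂ * s ^ b)).linear_preimage (LinearMap.mulLeft ℝ b)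
    have hse : 0 ≤ C * s ^ e := mul_nonneg hC (Real.rpow_nonneg hs.1.le _)
    have h4 : |Φ (potential b q R a u s) - Φ (potential b q R a v s)| ≤
        (C * s ^ e) ^ m * |potential b q R a u s - potential b q R a v s| := by
      refine hconv.norm_image_sub_le_of_norm_hasDerivWithin_le
        (fun x hx => (hΦ s (hsub s hs) x hx).1.hasDerivWithinAt) (fun x hx => ?_)
        (hmem v hv hvb s hs) (hmem u hu hub s hs)
      rw [Real.norm_eq_abs, abs_of_nonneg (Real.rpow_nonneg (abs_nonneg _) _)]
      exact Real.rpow_le_rpow (abs_nonneg _) (hΦ s (hsub s hs) x hx).2 hm.le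
    have h5 := abs_potential_sub_le (b := b) (R := R) hu hv ha
      (fun x => hB _ (hrange u hub x)) (fun x => hB _ (hrange v hvb x)) (c := Λ * d)
      (fun x => (hΛ _ (hrange u hub x) _ (hrange v hvb x)).trans (by gcongr; exact hd x)) hs.1
    have h6 : 0 ≤ d * (C * s ^ (2 * rho + e - 1)) :=
      mul_nonneg hd0 (mul_nonneg hC (Real.rpow_nonneg hs.1.le _))
    rw [← mul_sub, abs_mul, abs_of_pos h3]
    calc s ^ (2 * rho - 1) * |Φ (potential b q R a u s) - Φ (potential b q R a v s)|
        ≤ s ^ (2 * rho - 1) * ((C * s ^ e) ^ m * (|b|⁻¹ * (Λ * d * s ^ b))) := by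
          gcongr
          exact h4.trans (by gcongr)
      _ = d * (c₂ * s ^ (2 * rho + e * m + b - 1)) := by
        rw [Real.mul_rpow hC (Real.rpow_nonneg hs.1.le _), ← Real.rpow_mul hs.1.le,
          show 2 * rho + e * m + b - 1 = (2 * rho - 1) + e * m + b by ring,
          Real.rpow_add hs.1, Real.rpow_add hs.1, hc₂]
        ring
      _ ≤ _ := by rw [mul_add]; exact le_add_of_nonneg_left h6
  obtain ⟨u, hu, hub, hlim, hder⟩ := exists_integral_fixedPoint (gam := gam) (η := gam / 2)
    (R := R) (K := fun u s => s ^ (2 * rho - 1) * Φ (potential b q R a u s))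
    (g := fun s => C * s ^ (2 * rho + e - 1) + c₂ * s ^ (2 * rho + e * m + b - 1))
    (half_pos hgam).le
    (((integrableOn_Ioo_rpow he1 hR.1.le).const_mul C).add
      ((integrableOn_Ioo_rpow he2 hR.1.le).const_mul c₂))
    (hI.trans_le hRη) (hI.trans_le hR2)
    (fun u hu hub s hs => ((Real.continuousAt_rpow_const _ _ (.inl hs.1.ne')).mul
      (hdw u hu hub s hs).continuousAt).continuousWithinAt) hbound hlip
  exact ⟨u, hu, fun x => hB _ (hrange u hub x), hlim, fun r _ => hpos u hub r, hder,
    fun r hr => hdw u hu hub r hr⟩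

/-- For `b < 0` the parameter `a` of the potential is determined by the restriction of the solution
to `(0, R)`, so the construction yields infinitely many solutions. -/
theorem infiniteOn_of_family {b B₁ B₂ R : ℝ} (hb : b < 0) (hB₁ : 0 < B₁) (hB₁₂ : B₁ < B₂)
    (hR : 0 < R) {Φ : ℝ → ℝ} (hinj : InjOn Φ (Iio 0)) {A : Set (ℝ → ℝ)}
    (hA : ∀ a ∈ Icc B₁ B₂, ∃ u ∈ A, Continuous u ∧ (∀ x, u x ^ q ∈ Icc B₁ B₂) ∧
      ∀ s ∈ Ioo 0 R, HasDerivAt u (s ^ (2 * rho - 1) * Φ (potential b q R a u s)) s) :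
    InfiniteOn R A := by
  choose! U hUA hUc hUB hUd using hA
  have hmaps : MapsTo (fun a => (Ioo 0 R).domRestrict (U a)) (Icc B₁ B₂)
      ((fun u : ℝ → ℝ => (Ioo 0 R).domRestrict u) '' A) := fun a ha => ⟨U a, hUA a ha, rfl⟩
  refine infinite_of_injOn_mapsTo ?_ hmaps (Icc_infinite hB₁₂)
  intro a ha a' ha' heq
  have hEq : EqOn (U a) (U a') (Ioo 0 R) := fun s hs => congrFun heq ⟨s, hs⟩
  have hs : R / 2 ∈ Ioo 0 R := ⟨half_pos hR, half_lt_self hR⟩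
  have hder := ((hUd a ha _ hs).congr_of_eventuallyEq (f₁ := U a') (by
    filter_upwards [isOpen_Ioo.mem_nhds hs] with t ht using (hEq ht).symm)).unique
      (hUd a' ha' _ hs)
  have hΦ := mul_left_cancel₀ (Real.rpow_pos_of_pos hs.1 (2 * rho - 1)).ne' hder
  have hneg : ∀ a ∈ Icc B₁ B₂, potential b q R a (U a) (R / 2) < 0 := fun a ha => by
    have h1 := (potential_mem (R := R) hb.ne (hUc a ha) ha (hUB a ha) hs.1).1
    have h2 : 0 < B₁ * (R / 2) ^ b := mul_pos hB₁ (Real.rpow_pos_of_pos hs.1 _)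
    by_contra! h
    linarith [mul_nonpos_of_nonpos_of_nonneg hb.le h]
  have hpot := hinj (hneg a ha) (hneg a' ha') hΦ
  have hsub := potential_sub_of_neg hb (hUc a ha) (hUc a' ha') ha ha' (hUB a ha) (hUB a' ha')
    hEq hs
  rw [hpot, sub_self, mul_zero] at hsub
  exact sub_eq_zero.1 ((mul_eq_zero.1 hsub.symm).resolve_right (Real.rpow_pos_of_pos hR _).ne')

/-- Bounds for `x ^ q` on `[γ / 2, 3 γ / 2]`, made strict so that the interval of bounds is
nondegenerate even for `q = 0`. -/
theorem rpow_mem_Icc_of_near (hgam : 0 < gam) (hq : 0 ≤ q) :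
    0 < (gam / 2) ^ q / 2 ∧ (gam / 2) ^ q / 2 < (3 * gam / 2) ^ q + 1 ∧
    ∀ x ∈ Icc (gam / 2) (3 * gam / 2), x ^ q ∈ Icc ((gam / 2) ^ q / 2) ((3 * gam / 2) ^ q + 1) := by
  have h0 : 0 < (gam / 2) ^ q := Real.rpow_pos_of_pos (half_pos hgam) _
  have h1 : ∀ x ∈ Icc (gam / 2) (3 * gam / 2),
      x ^ q ∈ Icc ((gam / 2) ^ q / 2) ((3 * gam / 2) ^ q + 1) := by
    intro x hx
    have hx0 : 0 < x := (half_pos hgam).trans_le hx.1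
    have h2 : (gam / 2) ^ q ≤ x ^ q := Real.rpow_le_rpow (half_pos hgam).le hx.1 hq
    have h3 : x ^ q ≤ (3 * gam / 2) ^ q := Real.rpow_le_rpow hx0.le hx.2 hq
    constructor <;> linarith
  refine ⟨half_pos h0, ?_, h1⟩
  have h2 : (gam / 2) ^ q ≤ (3 * gam / 2) ^ q :=
    Real.rpow_le_rpow (half_pos hgam).le (by linarith) hq
  linarith

/-- Case `m = 1`, `β < 0`: the flow of `Φ' = |Φ|` is the exponential. -/
theorem infiniteOn_solutionSet_of_eq_one {N : ℕ} (hgam : 0 < gam) (hm : 0 < m) (hq : 0 ≤ q)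
    (hk : 0 < kappa m q) (hm1 : m = 1) (hb : beta rho m q theta < 0) :
    ∃ R, 0 < R ∧ InfiniteOn R (solutionSet N rho 0 theta m q gam R) := by
  subst hm1
  obtain ⟨hB₁, hB₁₂, hB⟩ := rpow_mem_Icc_of_near hgam hq
  set B₁ := (gam / 2) ^ q / 2
  set B₂ := (3 * gam / 2) ^ q + 1
  -- `exp φ` is smaller than any power of `r`; the exponent `1 - 2 ρ - β` makes both integrability
  -- exponents, `1 - β` and `1`, positive
  obtain ⟨R₀, hR₀, hexp⟩ := eventually_nhdsGT_zero_iff.1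
    ((tendsto_rpow_mul_exp_neg_rpow (k := -(1 - 2 * rho - beta rho 1 q theta)) hb
      (div_pos hB₁ (neg_pos.2 hb))).eventually_le_const one_pos)
  obtain ⟨R, hR, -, hfam⟩ := exists_radialSystem_of_flow (rho := rho) (theta := theta)
    (Φ := Real.exp) (C := 1) (e := 1 - 2 * rho - beta rho 1 q theta) hgam hm hb.ne hB hR₀ zero_le_one
    (by linarith) (by linarith) (fun s hs x hx => by
      rw [abs_of_pos (Real.exp_pos x), Real.rpow_one, one_mul]
      refine ⟨Real.hasDerivAt_exp x, ?_⟩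
      have h1 := hexp s hs
      rw [Real.rpow_neg hs.1.le, ← div_eq_inv_mul,
        div_le_one (Real.rpow_pos_of_pos hs.1 _)] at h1
      refine le_trans (Real.exp_le_exp.2 ?_) h1
      have h2 : -(B₁ / -beta rho 1 q theta) = B₁ / beta rho 1 q theta := by rw [div_neg, neg_neg]
      rw [h2, div_mul_eq_mul_div, le_div_iff_of_neg hb, mul_comm x]
      exact hx.1)
  refine ⟨R, hR, infiniteOn_of_family (rho := rho) (q := q) hb hB₁ hB₁₂ hR
    Real.exp_injective.injOn fun a ha => ?_⟩
  obtain ⟨u, hu, huB, hlim, hsys⟩ := hfam a ha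
  exact ⟨u, hsys.mem_solutionSet hm hk (fun r _ => (Real.exp_pos _).ne') hlim, hu, huB,
    hsys.hasDerivAt_u⟩

/-- The flow of `Φ' = |Φ|^m` that vanishes or blows up at time `0`, on the half-line `0 < b x`;
here `e = b / (1 - m)`, which determines the sign of `Φ`. -/
def powerFlow (b m : ℝ) (x : ℝ) : ℝ :=
  Real.sign (b / (1 - m)) * (b * x / |b / (1 - m)|) ^ (1 / (1 - m))

section PowerFlow

variable {b : ℝ}

theorem sign_eq_one_or {x : ℝ} (hx : x ≠ 0) : Real.sign x = 1 ∨ Real.sign x = -1 :=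
  (Real.sign_apply_eq_of_ne_zero x hx).symm

theorem sign_mul_self_eq_abs (x : ℝ) : Real.sign x * x = |x| := by
  rcases lt_trichotomy x 0 with h | h | h
  · rw [Real.sign_of_neg h, abs_of_neg h, neg_one_mul]
  · simp [h]
  · rw [Real.sign_of_pos h, abs_of_pos h, one_mul]

theorem abs_powerFlow (hb : b ≠ 0) (hm1 : m ≠ 1) {x : ℝ} (hx : 0 < b * x) :
    |powerFlow b m x| = (b * x / |b / (1 - m)|) ^ (1 / (1 - m)) := by
  have he : b / (1 - m) ≠ 0 := div_ne_zero hb (sub_ne_zero.2 hm1.symm)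
  rw [powerFlow, abs_mul, abs_of_pos (Real.rpow_pos_of_pos (by positivity) _)]
  rcases sign_eq_one_or he with h | h <;> rw [h] <;> simp

theorem hasDerivAt_powerFlow (hb : b ≠ 0) (hm1 : m ≠ 1) {x : ℝ} (hx : 0 < b * x) :
    HasDerivAt (powerFlow b m) (|powerFlow b m x| ^ m) x := by
  have h1 : 1 - m ≠ 0 := sub_ne_zero.2 hm1.symm
  have he : b / (1 - m) ≠ 0 := div_ne_zero hb h1
  have hy : 0 < b * x / |b / (1 - m)| := by positivity
  have h2 := ((((hasDerivAt_id x).const_mul b).div_const |b / (1 - m)|).rpow_const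
    (p := 1 / (1 - m)) (.inl hy.ne')).const_mul (Real.sign (b / (1 - m)))
  refine h2.congr_deriv ?_
  rw [abs_powerFlow hb hm1 hx, ← Real.rpow_mul hy.le,
    show 1 / (1 - m) - 1 = 1 / (1 - m) * m by field_simp; ring]
  simp only [id]
  generalize (b * x / |b / (1 - m)|) ^ (1 / (1 - m) * m) = A
  have h3 : Real.sign (b / (1 - m)) * (b / (1 - m)) = |b / (1 - m)| :=
    sign_mul_self_eq_abs _
  have h4 : |b / (1 - m)| ≠ 0 := abs_ne_zero.2 he
  calc _ = (Real.sign (b / (1 - m)) * (b / (1 - m))) / |b / (1 - m)| * A := by ring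
    _ = A := by rw [h3, div_self h4, one_mul]

theorem powerFlow_ne_zero (hb : b ≠ 0) (hm1 : m ≠ 1) {x : ℝ} (hx : 0 < b * x) :
    powerFlow b m x ≠ 0 := by
  have he : b / (1 - m) ≠ 0 := div_ne_zero hb (sub_ne_zero.2 hm1.symm)
  rw [← abs_ne_zero, abs_powerFlow hb hm1 hx]
  exact (Real.rpow_pos_of_pos (by positivity) _).ne'

/-- `powerFlow` inverts the primitive `|w|^(1-m) sgn w / (1-m)`. -/
theorem primitive_powerFlow (hb : b ≠ 0) (hm1 : m ≠ 1) {x : ℝ} (hx : 0 < b * x) :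
    0 < Real.sign (b / (1 - m)) * powerFlow b m x ∧
    Real.sign (b / (1 - m)) * ((Real.sign (b / (1 - m)) * powerFlow b m x) ^ (1 - m) / (1 - m)) =
      x := by
  have h1 : 1 - m ≠ 0 := sub_ne_zero.2 hm1.symm
  have he : b / (1 - m) ≠ 0 := div_ne_zero hb h1
  have hy : 0 < b * x / |b / (1 - m)| := by positivity
  have h2 : Real.sign (b / (1 - m)) * Real.sign (b / (1 - m)) = 1 := by
    rcases sign_eq_one_or he with h | h <;> rw [h] <;> norm_num
  have h3 : Real.sign (b / (1 - m)) * powerFlow b m x =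
      (b * x / |b / (1 - m)|) ^ (1 / (1 - m)) := by
    rw [powerFlow, ← mul_assoc, h2, one_mul]
  rw [h3]
  refine ⟨Real.rpow_pos_of_pos hy _, ?_⟩
  rw [← Real.rpow_mul hy.le, one_div_mul_cancel h1, Real.rpow_one]
  have h4 : Real.sign (b / (1 - m)) * (b / (1 - m)) = |b / (1 - m)| :=
    sign_mul_self_eq_abs _
  calc _ = (Real.sign (b / (1 - m)) * (b / (1 - m))) / |b / (1 - m)| * x := by ring
    _ = x := by rw [h4, div_self (abs_ne_zero.2 he), one_mul]

theorem abs_powerFlow_le (hb : b ≠ 0) (hm1 : m ≠ 1) {B₁ B₂ s x : ℝ} (hB₁ : 0 < B₁) (hs : 0 < s)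
    (hx : b * x ∈ Icc (B₁ * s ^ b) (B₂ * s ^ b)) :
    |powerFlow b m x| ≤ max ((B₁ / |b / (1 - m)|) ^ (1 / (1 - m)))
      ((B₂ / |b / (1 - m)|) ^ (1 / (1 - m))) * s ^ (b / (1 - m)) := by
  have h1 : 1 - m ≠ 0 := sub_ne_zero.2 hm1.symm
  have he : b / (1 - m) ≠ 0 := div_ne_zero hb h1
  have hsb : 0 < s ^ b := Real.rpow_pos_of_pos hs b
  have hbx : 0 < b * x := (mul_pos hB₁ hsb).trans_le hx.1
  obtain ⟨l, hl⟩ : ∃ l, l = b * x / s ^ b := ⟨_, rfl⟩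
  have hl1 : B₁ ≤ l := by rw [hl, le_div_iff₀ hsb]; exact hx.1
  have hl2 : l ≤ B₂ := by rw [hl, div_le_iff₀ hsb]; exact hx.2
  have hl0 : 0 < l := hB₁.trans_le hl1
  have hB₂ : 0 < B₂ := hl0.trans_le hl2
  have hbx' : b * x / |b / (1 - m)| = l / |b / (1 - m)| * s ^ b := by rw [hl]; field_simp
  rw [abs_powerFlow hb hm1 hbx, hbx', Real.mul_rpow (by positivity) hsb.le,
    ← Real.rpow_mul hs.le, mul_one_div]
  refine mul_le_mul_of_nonneg_right ?_ (Real.rpow_nonneg hs.le _)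
  rcases le_total 0 (1 / (1 - m)) with h | h
  · refine le_max_of_le_right (Real.rpow_le_rpow (by positivity) (by gcongr) h)
  · refine le_max_of_le_left (Real.rpow_le_rpow_of_nonpos (by positivity) (by gcongr) h)

end PowerFlow

end Existence

/-! ### The branches of the existence statement -/

section Branches

variable {rho m q theta gam : ℝ}

theorem exists_radialSystem_powerFlow (hgam : 0 < gam) (hm : 0 < m) (hm1 : m ≠ 1)
    (hb : beta rho m q theta ≠ 0) (hz : 0 < zeta m q theta) {B₁ B₂ : ℝ} (hB₁ : 0 < B₁)
    (hB : ∀ x ∈ Icc (gam / 2) (3 * gam / 2), x ^ q ∈ Icc B₁ B₂) :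
    ∃ R, 0 < R ∧ ∀ a ∈ Icc B₁ B₂, ∃ u : ℝ → ℝ, Continuous u ∧
      (∀ x, u x ^ q ∈ Icc B₁ B₂) ∧ Tendsto u (𝓝[>] 0) (𝓝 gam) ∧
      RadialSystem rho m q theta R u (fun s => powerFlow (beta rho m q theta) m
        (potential (beta rho m q theta) q R a u s)) := by
  have he : zeta m q theta = 2 * rho + beta rho m q theta / (1 - m) := by
    rw [← zeta_sub hm1]; ring
  have h1 : 1 - m ≠ 0 := sub_ne_zero.2 hm1.symm
  have hb' : beta rho m q theta / (1 - m) * m + beta rho m q theta =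
      beta rho m q theta / (1 - m) := by field_simp; ring
  obtain ⟨R, hR, -, hfam⟩ := exists_radialSystem_of_flow (rho := rho) (theta := theta)
    (Φ := powerFlow (beta rho m q theta) m)
    (C := max ((B₁ / |beta rho m q theta / (1 - m)|) ^ (1 / (1 - m)))
      ((B₂ / |beta rho m q theta / (1 - m)|) ^ (1 / (1 - m))))
    (e := beta rho m q theta / (1 - m)) hgam hm hb hB one_pos
    (le_max_of_le_left (Real.rpow_nonneg (by positivity) _)) (by linarith) (by linarith)
    (fun s hs x hx => ⟨hasDerivAt_powerFlow hb hm1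
        ((mul_pos hB₁ (Real.rpow_pos_of_pos hs.1 _)).trans_le hx.1),
      abs_powerFlow_le hb hm1 hB₁ hs.1 hx⟩)
  exact ⟨R, hR, hfam⟩

/-- For `β > 0` the solution with `φ(0) = 0` has the pure power behaviour. -/
theorem exists_powerExpansion_of_pos {N : ℕ} (hgam : 0 < gam) (hm : 0 < m) (hq : 0 ≤ q)
    (hk : 0 < kappa m q) (hm1 : m ≠ 1) (hb : 0 < beta rho m q theta)
    (hz : 0 < zeta m q theta) :
    ∃ R, 0 < R ∧ ∃ u ∈ solutionSet N rho 0 theta m q gam R,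
      PowerExpansion rho m q theta gam u := by
  obtain ⟨hB₁, hB₁₂, hB⟩ := rpow_mem_Icc_of_near hgam hq
  set B₁ := (gam / 2) ^ q / 2
  set B₂ := (3 * gam / 2) ^ q + 1
  obtain ⟨R, hR, hfam⟩ := exists_radialSystem_powerFlow hgam hm hm1 hb.ne' hz hB₁ hB
  have ha : B₁ ∈ Icc B₁ B₂ := left_mem_Icc.2 hB₁₂.le
  obtain ⟨u, hu, huB, hlim, hsys⟩ := hfam B₁ ha
  set φ := potential (beta rho m q theta) q R B₁ u with hφ
  have hpos : ∀ s ∈ Ioo 0 R, 0 < beta rho m q theta * φ s := fun s hs =>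
    (mul_pos hB₁ (Real.rpow_pos_of_pos hs.1 _)).trans_le
      (potential_mem hb.ne' hu ha huB hs.1).1
  have hev : ∀ᶠ s in 𝓝[>] 0, s ∈ Ioo 0 R := Ioo_mem_nhdsGT hR
  refine ⟨R, hR, u, hsys.mem_solutionSet hm hk
    (fun r hr => powerFlow_ne_zero hb.ne' hm1 (hpos r hr)) hlim, ?_⟩
  have he : beta rho m q theta / (1 - m) ≠ 0 := div_ne_zero hb.ne' (sub_ne_zero.2 hm1.symm)
  refine (hsys.powerExpansion hR hgam hlim hm1 hb.ne' (sign_eq_one_or he)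
    (hev.mono fun r hr => (primitive_powerFlow hb.ne' hm1 (hpos r hr)).1) ?_).2
  -- the potential starts from `0`, which fixes the constant of integration
  have hφ0 : Tendsto φ (𝓝[>] 0) (𝓝 0) := by
    have h1 : Tendsto (fun s => beta rho m q theta * φ s) (𝓝[>] 0) (𝓝 0) := by
      refine squeeze_zero' (hev.mono fun s hs => (hpos s hs).le)
        (hev.mono fun s hs => (potential_mem hb.ne' hu ha huB hs.1).2) ?_
      simpa using (tendsto_rpow_nhdsGT_zero hb).const_mul B₂
    refine (by simpa using h1.const_mul (beta rho m q theta)⁻¹ :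
      Tendsto (fun s => (beta rho m q theta)⁻¹ * (beta rho m q theta * φ s)) (𝓝[>] 0)
        (𝓝 0)).congr fun s => ?_
    rw [inv_mul_cancel_left₀ hb.ne']
  have hφd : ∀ᶠ s in 𝓝[>] 0, HasDerivAt
      (fun r => Real.sign (beta rho m q theta / (1 - m)) *
        ((Real.sign (beta rho m q theta / (1 - m)) *
          powerFlow (beta rho m q theta) m (φ r)) ^ (1 - m) / (1 - m)))
      (s ^ (beta rho m q theta - 1) * u s ^ q) s :=
    hev.mono fun s hs => hasDerivAt_power_primitive
      (w := fun s => powerFlow (beta rho m q theta) m (φ s)) (sign_eq_one_or he) hm1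
      (primitive_powerFlow hb.ne' hm1 (hpos s hs)).1 (hsys.hasDerivAt_w s hs)
  have hprim : (fun r => Real.sign (beta rho m q theta / (1 - m)) *
        ((Real.sign (beta rho m q theta / (1 - m)) *
          powerFlow (beta rho m q theta) m (φ r)) ^ (1 - m) / (1 - m))) =ᶠ[𝓝[>] 0] φ :=
    hev.mono fun s hs => (primitive_powerFlow hb.ne' hm1 (hpos s hs)).2
  have := isEquivalent_sub_of_deriv hb (Real.rpow_pos_of_pos hgam q).ne' hφd
    (hφ0.congr' hprim.symm) (weight_isEquivalent hgam hlim)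
  simpa only [sub_zero] using this

/-- For `β < 0` every value of the parameter of the potential gives a solution; the expansion itself
is known for all solutions. -/
theorem infiniteOn_powerExpansion_of_neg {N : ℕ} (hgam : 0 < gam) (hm : 0 < m) (hq : 0 ≤ q)
    (hk : 0 < kappa m q) (hm1 : m ≠ 1) (hb : beta rho m q theta < 0)
    (hz : 0 < zeta m q theta)
    (hexp : ∀ R, 0 < R → ∀ u ∈ solutionSet N rho 0 theta m q gam R,
      PowerExpansion rho m q theta gam u) :
    ∃ R, 0 < R ∧ InfiniteOn R {u | u ∈ solutionSet N rho 0 theta m q gam R ∧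
      PowerExpansion rho m q theta gam u} := by
  obtain ⟨hB₁, hB₁₂, hB⟩ := rpow_mem_Icc_of_near hgam hq
  set B₁ := (gam / 2) ^ q / 2
  set B₂ := (3 * gam / 2) ^ q + 1
  obtain ⟨R, hR, hfam⟩ := exists_radialSystem_powerFlow hgam hm hm1 hb.ne hz hB₁ hB
  refine ⟨R, hR, infiniteOn_of_family (rho := rho) (q := q) (Φ := powerFlow (beta rho m q theta) m)
    hb hB₁ hB₁₂ hR ?_ fun a ha => ?_⟩
  · intro x hx y hy hxy
    rw [← (primitive_powerFlow hb.ne hm1 (mul_pos_of_neg_of_neg hb hx)).2, hxy,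
      (primitive_powerFlow hb.ne hm1 (mul_pos_of_neg_of_neg hb hy)).2]
  · obtain ⟨u, hu, huB, hlim, hsys⟩ := hfam a ha
    have hmem : u ∈ solutionSet N rho 0 theta m q gam R :=
      hsys.mem_solutionSet hm hk (fun r hr => powerFlow_ne_zero hb.ne hm1
        ((mul_pos hB₁ (Real.rpow_pos_of_pos hr.1 _)).trans_le
          (potential_mem hb.ne hu ha huB hr.1).1)) hlim
    exact ⟨u, ⟨hmem, hexp R hR u hmem⟩, hu, huB, hsys.hasDerivAt_u⟩

/-- A local solution of `Φ' = |Φ|^m` with `Φ(0) = w₀ ≠ 0`, where the right-hand side is smooth. -/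
theorem exists_flow {w₀ : ℝ} (hw₀ : w₀ ≠ 0) (m : ℝ) :
    ∃ Φ : ℝ → ℝ, Φ 0 = w₀ ∧ ∃ ε > 0, ∀ x, |x| < ε →
      HasDerivAt Φ (|Φ x| ^ m) x ∧ |Φ x| ≤ 2 * |w₀| ∧ Φ x ≠ 0 := by
  have hsm : ContDiffAt ℝ 1 (fun y : ℝ => |y| ^ m) w₀ :=
    (contDiffAt_abs hw₀).rpow_const_of_ne (abs_ne_zero.2 hw₀)
  obtain ⟨Φ, hΦ0, ε, hε, hΦ⟩ :=
    hsm.exists_forall_mem_closedBall_exists_eq_forall_mem_Ioo_hasDerivAt₀ 0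
  have hcont : ContinuousAt Φ 0 := (hΦ 0 ⟨by linarith, by linarith⟩).continuousAt
  have hpos : 0 < |w₀| := abs_pos.2 hw₀
  have h1 : ∀ᶠ x in 𝓝 (0 : ℝ), |Φ x| ≤ 2 * |w₀| ∧ Φ x ≠ 0 := by
    refine ((hcont.abs).eventually_le_const (by simp only [hΦ0]; linarith)).and
      (hcont.eventually_ne (by rwa [hΦ0]))
  obtain ⟨δ, hδ, hδ'⟩ := Metric.eventually_nhds_iff.1 h1
  refine ⟨Φ, hΦ0, min ε δ, lt_min hε hδ, fun x hx => ⟨hΦ x ?_, hδ' ?_⟩⟩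
  · have := abs_lt.1 (hx.trans_le (min_le_left _ _))
    exact ⟨by linarith, by linarith⟩
  · rw [dist_zero_right]
    exact hx.trans_le (min_le_right _ _)

/-- Since `β > 0`, the potential vanishes at `0`, so `w = Φ ∘ φ` starts from the prescribed value
`w₀ = 2 ρ C₁`. -/
theorem exists_refinedExpansion {N : ℕ} (hgam : 0 < gam) (hm : 0 < m) (hq : 0 ≤ q)
    (hk : 0 < kappa m q) (hb : 0 < beta rho m q theta) (hrho : 0 < rho) {C₁ : ℝ} (hC₁ : C₁ ≠ 0) :
    ∃ R, 0 < R ∧ ∃ u ∈ solutionSet N rho 0 theta m q gam R,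
      RefinedExpansion rho m q theta gam C₁ u := by
  obtain ⟨hB₁, hB₁₂, hB⟩ := rpow_mem_Icc_of_near hgam hq
  set B₁ := (gam / 2) ^ q / 2
  set B₂ := (3 * gam / 2) ^ q + 1
  have hw₀ : 2 * rho * C₁ ≠ 0 := by positivity
  obtain ⟨Φ, hΦ0, ε, hε, hΦ⟩ := exists_flow hw₀ m
  have hsmall : Tendsto (fun s : ℝ => B₂ * s ^ beta rho m q theta / beta rho m q theta) (𝓝[>] 0)
      (𝓝 0) := by
    simpa using ((tendsto_rpow_nhdsGT_zero hb).const_mul B₂).div_const (beta rho m q theta)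
  obtain ⟨R₀, hR₀, hlt⟩ := eventually_nhdsGT_zero_iff.1 (hsmall.eventually_lt_const hε)
  have habs : ∀ s, 0 < s → ∀ x, beta rho m q theta * x ∈
      Icc (B₁ * s ^ beta rho m q theta) (B₂ * s ^ beta rho m q theta) →
      |x| ≤ B₂ * s ^ beta rho m q theta / beta rho m q theta := by
    intro s hs x hx
    have h1 : 0 < beta rho m q theta * x :=
      (mul_pos hB₁ (Real.rpow_pos_of_pos hs _)).trans_le hx.1
    rw [abs_of_pos (pos_of_mul_pos_right h1 hb.le), le_div_iff₀ hb, mul_comm x]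
    exact hx.2
  obtain ⟨R, hR, hRR₀, hfam⟩ := exists_radialSystem_of_flow (rho := rho) (theta := theta) (Φ := Φ)
    (C := 2 * |2 * rho * C₁|) (e := 0) hgam hm hb.ne' hB hR₀ (by positivity) (by linarith)
    (by linarith) (fun s hs x hx => by
      obtain ⟨h1, h2, -⟩ := hΦ x ((habs s hs.1 x hx).trans_lt (hlt s hs))
      exact ⟨h1, by rwa [Real.rpow_zero, mul_one]⟩)
  have ha : B₁ ∈ Icc B₁ B₂ := left_mem_Icc.2 hB₁₂.le
  obtain ⟨u, hu, huB, hlim, hsys⟩ := hfam B₁ ha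
  have hφle : ∀ s ∈ Ioo 0 R, |potential (beta rho m q theta) q R B₁ u s| ≤
      B₂ * s ^ beta rho m q theta / beta rho m q theta := fun s hs =>
    habs s hs.1 _ (potential_mem hb.ne' hu ha huB hs.1)
  refine ⟨R, hR, u, hsys.mem_solutionSet hm hk (fun r hr => (hΦ _ ((hφle r hr).trans_lt
    (hlt r ⟨hr.1, hr.2.trans_le hRR₀⟩))).2.2) hlim, ?_⟩
  have hφ0 : Tendsto (potential (beta rho m q theta) q R B₁ u) (𝓝[>] 0) (𝓝 0) :=
    squeeze_zero_norm' (by filter_upwards [Ioo_mem_nhdsGT hR] with s hs using hφle s hs) hsmall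
  have hΦc : ContinuousAt Φ 0 := (hΦ 0 (by simpa using hε)).1.continuousAt
  have hw : Tendsto (fun s => Φ (potential (beta rho m q theta) q R B₁ u s)) (𝓝[>] 0)
      (𝓝 (2 * rho * C₁)) := by
    have := hΦc.tendsto.comp hφ0
    rwa [hΦ0] at this
  have := (hsys.refinedExpansion hR hgam hlim hb hw₀ hw).2
  rwa [mul_div_cancel_left₀ _ (by positivity : 2 * rho ≠ 0)] at this

end Branches

end HardyGradient

end

open HardyGradient

theorem theorem1p3 (N : ℕ) (hN : 2 ≤ N) (rho theta m q gam : ℝ)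
    (hm : 0 < m) (hq : 0 ≤ q) (hkappa : 0 < HardyGradient.kappa m q)
    (hbeta : HardyGradient.beta rho m q theta ≠ 0) (hgam : 0 < gam) :
    -- (A)
    (HardyGradient.CaseI rho m q theta →
      (∀ R : ℝ, 0 < R → ∀ u ∈ HardyGradient.solutionSet N rho 0 theta m q gam R,
        (∀ r ∈ Ioo 0 R, 0 < deriv u r) ∧
        ∃ C : ℝ, 0 < C ∧ HardyGradient.ExpExpansion rho q theta gam C u) ∧
      (∃ R : ℝ, 0 < R ∧
        HardyGradient.InfiniteOn R (HardyGradient.solutionSet N rho 0 theta m q gam R))) ∧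
    -- (B)
    (HardyGradient.CaseII rho m q theta → HardyGradient.CaseIII rho m q theta →
      ∀ R : ℝ, 0 < R → ∀ u ∈ HardyGradient.solutionSet N rho 0 theta m q gam R,
        HardyGradient.PowerExpansion rho m q theta gam u ∨
        ∃ C₁ : ℝ, C₁ ≠ 0 ∧ HardyGradient.RefinedExpansion rho m q theta gam C₁ u) ∧
    -- (C)
    (HardyGradient.CaseII rho m q theta →
      (0 < HardyGradient.beta rho m q theta →
        ∃ R : ℝ, 0 < R ∧ ∃ u ∈ HardyGradient.solutionSet N rho 0 theta m q gam R,
          HardyGradient.PowerExpansion rho m q theta gam u) ∧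
      (HardyGradient.beta rho m q theta < 0 →
        ∃ R : ℝ, 0 < R ∧ HardyGradient.InfiniteOn R
          {u | u ∈ HardyGradient.solutionSet N rho 0 theta m q gam R ∧
            HardyGradient.PowerExpansion rho m q theta gam u}) ∧
      (¬ HardyGradient.CaseIII rho m q theta →
        ∀ R : ℝ, 0 < R → ∀ u ∈ HardyGradient.solutionSet N rho 0 theta m q gam R,
          HardyGradient.PowerExpansion rho m q theta gam u)) ∧
    -- (D)
    (HardyGradient.CaseIII rho m q theta →
      (∀ C₁ : ℝ, C₁ ≠ 0 →
        ∃ R : ℝ, 0 < R ∧ ∃ u ∈ HardyGradient.solutionSet N rho 0 theta m q gam R,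
          HardyGradient.RefinedExpansion rho m q theta gam C₁ u) ∧
      (¬ HardyGradient.CaseII rho m q theta →
        ∀ R : ℝ, 0 < R → ∀ u ∈ HardyGradient.solutionSet N rho 0 theta m q gam R,
          ∃ C₁ : ℝ, C₁ ≠ 0 ∧ HardyGradient.RefinedExpansion rho m q theta gam C₁ u)) := by
  have hsys : ∀ R : ℝ, 0 < R → ∀ u ∈ solutionSet N rho 0 theta m q gam R,
      ∃ w, RadialSystem rho m q theta R u w ∧ Tendsto u (𝓝[>] 0) (𝓝 gam) ∧
        ∀ r ∈ Ioo 0 R, ∃ s ∈ Ioo 0 r, u s ≠ gam := by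
    rintro R - u ⟨hu, hlim, hstar⟩
    obtain ⟨w, hw⟩ := exists_radialSystem hN hkappa hu
    exact ⟨w, hw, hlim, rStar_eq_zero_iff.1 hstar⟩
  have hdich : m ≠ 1 → ∀ R : ℝ, 0 < R → ∀ u ∈ solutionSet N rho 0 theta m q gam R,
      (CaseII rho m q theta ∧ PowerExpansion rho m q theta gam u) ∨
      (CaseIII rho m q theta ∧ ∃ C₁ : ℝ, C₁ ≠ 0 ∧ RefinedExpansion rho m q theta gam C₁ u) := by
    intro hm1 R hR u hu
    obtain ⟨w, hw, hlim, hne⟩ := hsys R hR u hu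
    rcases hw.expansion_of_ne_one hR hgam hlim hne hm1 hbeta with ⟨hz, h⟩ | ⟨hb, hrho, h⟩
    · exact .inl ⟨caseII_of_zeta_pos hkappa hm1 hbeta hz, h⟩
    · exact .inr ⟨⟨hb, hrho⟩, h⟩
  have hpow : CaseII rho m q theta → ¬ CaseIII rho m q theta →
      ∀ R : ℝ, 0 < R → ∀ u ∈ solutionSet N rho 0 theta m q gam R,
        PowerExpansion rho m q theta gam u := fun hII hIII R hR u hu =>
    ((hdich hII.2.1 R hR u hu).resolve_right fun h => hIII h.1).2
  refine ⟨fun hI => ⟨fun R hR u hu => ?_, ?_⟩, fun hII hIII R hR u hu => ?_,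
    fun hII => ⟨fun hb => ?_, fun hb => ?_, hpow hII⟩,
    fun hIII => ⟨fun C₁ hC₁ => ?_, fun hII R hR u hu => ?_⟩⟩
  · obtain ⟨w, hw, hlim, hne⟩ := hsys R hR u hu
    obtain ⟨hpos, hexp⟩ := hw.expExpansion hR hgam hkappa hlim hne hI.2 hI.1
    refine ⟨fun r hr => ?_, hexp⟩
    rw [(hw.hasDerivAt_u r hr).deriv]
    exact mul_pos (Real.rpow_pos_of_pos hr.1 _) (hpos r hr)
  · exact infiniteOn_solutionSet_of_eq_one hgam hm hq hkappa hI.2 hI.1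
  · exact (hdich hII.2.1 R hR u hu).imp And.right And.right
  · exact exists_powerExpansion_of_pos hgam hm hq hkappa hII.2.1 hb (hII.zeta_pos hkappa)
  · exact infiniteOn_powerExpansion_of_neg hgam hm hq hkappa hII.2.1 hb (hII.zeta_pos hkappa)
      (hpow hII fun h => absurd h.1 (not_lt.2 hb.le))
  · exact exists_refinedExpansion hgam hm hq hkappa hIII.1 hIII.2 hC₁
  · by_cases hm1 : m = 1
    · obtain ⟨w, hw, hlim, hne⟩ := hsys R hR u hu
      exact hw.refinedExpansion_of_eq_one hR hgam hlim hne hm1 hIII.1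
    · exact ((hdich hm1 R hR u hu).resolve_left fun h => hII h.1).2
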